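/- Let $\mathcal E$ be a category with finite limits. Call a morphism $p\colon P_*\to P$ of $\mathcal E$ a \emph{polynomial} if it is exponentiable, i.e. if the pullback functor $\Delta_p\colon \mathcal E/P\to\mathcal E/P_*$ has a right adjoint $\Pi_p$. A morphism $\phi$ from $p\colon P_*\to P$ to $q\colon Q_*\to Q$ is a triple consisting of a map $\phi_1\colon P\to Q$, a pullback $P\times_Q Q_*$ of $q$ along $\phi_1$, and a map $\phi^\sharp\colon P\times_Q Q_*\to P_*$ over $P$, two such triples being identified if they have the same $\phi_1$ and differ by an isomorphism between the choices of the pullback. The composite of $\phi\colon p\to q$ and $\psi\colon q\to r$ has components $\psi_1\circ\phi_1$ and $P\times_R R_*\cong P\times_Q(Q\times_R R_*)\xrightarrow{P\times_Q\psi^\sharp}P\times_Q Q_*\xrightarrow{\phi^\sharp}P_*$. This defines a category $\mathbf{Poly}_{\mathcal E}$. Let $y=\mathrm{id}_1$ for $1$ the terminal object. For polynomials $p,q$ let $B=\Pi_p(Q\times P_*\to P_*)$, with structure map $B\to P$, and let $B\times_P P_*\to Q$ be the counit $B\times_P P_*\to Q\times P_*$ followed by the projection. Let $p\triangleleft q$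 be the composite $(B\times_P P_*)\times_Q Q_*\to B\times_P P_*\to B$, which is again a polynomial. By the universal property of $\Pi_p$, maps $X\to B$ correspond to pairs consisting of $b\colon X\to P$ and $u\colon X\times_P P_*\to Q$, and the pullback of $p\triangleleft q$ along the map given by $(b,u)$ is $(X\times_P P_*)\times_Q Q_*\to X\times_P P_* \to X$. Then $(\mathbf{Poly}_{\mathcal E},y,\triangleleft)$ is a monoidal category, with the following structure. (a) For $\phi\colon p\to p'$ and $\psi\colon q\to q'$, the morphism $\phi\triangleleft\psi\colon p\triangleleft q\to p'\triangleleft q'$ is given on positions by the pair of $B\to P\xrightarrow{\phi_1}P'$ and $B\times_{P'}P'_*\to B\times_P P_*\to Q\xrightarrow{\psi_1}Q'$, where the first map is induced by $\phi^\sharp$, and on directions by the map $(B\times_{P'}P'_*)\times_{Q'}Q'_*\to(B\times_P P_*)\times_Q Q_*$ induced by $\phi^\sharp$ and $\psi^\sharp$. (b) The associator $(p\triangleleft q)\triangleleft r\to p\triangleleft(q\triangleleft r)$ and the unitors $y\triangleleft p\to p$ and $p\triangleleft y\to p$ are the canonical ones; each is the identity on directions (for the evident choice of pullback). On positions the associator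 corresponds, under the universal properties, to regrouping the data $X\to P$, $X\times_P P_*\to Q$, $(X\times_P P_*)\times_Q Q_*\to R$; the left unitor is $\Pi_{\mathrm{id}_1}(P\times 1)\cong\Pi_{\mathrm{id}_1}(P\times 1)\times_1 1\to P$, given by the counit; and the right unitor is the structure map $\Pi_p(1\times P_*)\to P$. That is, these three families consist of isomorphisms in $\mathbf{Poly}_{\mathcal E}$, $\triangleleft$ is a functor in both variables, the three families are natural, and the pentagon and triangle identities hold. -/

import Mathlib

open CategoryTheory CategoryTheory.Limits

universe v u

/-- A morphism `f : B ⟶ A` of a category with pullbacks is exponentiable if the pullback functor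
`E/A ⥤ E/B` has a right adjoint. -/
def IsExp {E : Type u} [Category.{v} E] [HasPullbacks E] {B A : E} (f : B ⟶ A) : Prop :=
  (Over.pullback f).IsLeftAdjoint

namespace IsExp

variable {E : Type u} [Category.{v} E] [HasPullbacks E]

theorem id (A : E) : IsExp (𝟙 A) :=
  ((Adjunction.id (C := Over A)).ofNatIsoLeft Over.pullbackId.symm).isLeftAdjoint

theorem comp {C B A : E} {f : C ⟶ B} {g : B ⟶ A} (hf : IsExp f) (hg : IsExp g) :
    IsExp (f ≫ g) := by
  have : (Over.pullback f).IsLeftAdjoint := hf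
  have : (Over.pullback g).IsLeftAdjoint := hg
  exact ((Adjunction.ofIsLeftAdjoint (Over.pullback g ⋙ Over.pullback f)).ofNatIsoLeft
    (Over.pullbackComp f g).symm).isLeftAdjoint

theorem isPullback_baseChange {B' B A' A X : E} {k : B' ⟶ B} {f' : B' ⟶ A'} {f : B ⟶ A}
    {g : A' ⟶ A} (h : IsPullback k f' f g) (x : X ⟶ A') :
    IsPullback (pullback.fst x f') (pullback.snd x f' ≫ k) (x ≫ g) f :=
  (IsPullback.of_hasPullback x f').paste_vert h.flip

/-- The base change isomorphism of a pullback square. -/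
noncomputable def baseChange {B' B A' A : E} {k : B' ⟶ B} {f' : B' ⟶ A'} {f : B ⟶ A} {g : A' ⟶ A}
    (h : IsPullback k f' f g) :
    Over.pullback f' ⋙ Over.map k ≅ Over.map g ⋙ Over.pullback f :=
  NatIso.ofComponents
    (fun X => Over.isoMk (isPullback_baseChange h X.hom).isoPullback
      (isPullback_baseChange h X.hom).isoPullback_hom_snd)
    (by
      intro X Y t
      have key : pullback.lift (pullback.fst X.hom f' ≫ t.left) (pullback.snd X.hom f')
            (by rw [Category.assoc, Over.w, pullback.condition]) ≫
            (isPullback_baseChange h Y.hom).isoPullback.hom =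
          (isPullback_baseChange h X.hom).isoPullback.hom ≫
            pullback.lift (f := Y.hom ≫ g) (g := f) (pullback.fst (X.hom ≫ g) f ≫ t.left)
              (pullback.snd (X.hom ≫ g) f)
              (by rw [Category.assoc, Over.w_assoc, pullback.condition]) := by
        apply pullback.hom_ext
        · rw [Category.assoc, IsPullback.isoPullback_hom_fst, pullback.lift_fst, Category.assoc,
            pullback.lift_fst, IsPullback.isoPullback_hom_fst_assoc]
        · rw [Category.assoc, IsPullback.isoPullback_hom_snd, pullback.lift_snd_assoc,
            Category.assoc, pullback.lift_snd, IsPullback.isoPullback_hom_snd]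
      exact Over.OverMorphism.ext key)

/-- Each unit component of `Over.map k ⊣ Over.pullback k` is an equalizer. -/
noncomputable def regularMonoUnit {B' B : E} (k : B' ⟶ B) (X : Over B') :
    RegularMono ((Over.mapPullbackAdj k).unit.app X) where
  Z := Over.mk (pullback.snd k k)
  left := Over.homMk (pullback.lift (pullback.fst (X.hom ≫ k) k ≫ X.hom)
    (pullback.snd (X.hom ≫ k) k) (by rw [Category.assoc, pullback.condition]))
    (pullback.lift_snd _ _ _)
  right := Over.homMk (pullback.lift (pullback.snd (X.hom ≫ k) k) (pullback.snd (X.hom ≫ k) k) rfl)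
    (pullback.lift_snd _ _ _)
  w := by
    have key : pullback.lift (f := X.hom ≫ k) (g := k) (𝟙 X.left) X.hom (Category.id_comp _) ≫
          pullback.lift (pullback.fst (X.hom ≫ k) k ≫ X.hom) (pullback.snd (X.hom ≫ k) k)
            (by rw [Category.assoc, pullback.condition]) =
        pullback.lift (f := X.hom ≫ k) (g := k) (𝟙 X.left) X.hom (Category.id_comp _) ≫
          pullback.lift (pullback.snd (X.hom ≫ k) k) (pullback.snd (X.hom ≫ k) k) rfl := by
      apply pullback.hom_ext
      · rw [Category.assoc, pullback.lift_fst, pullback.lift_fst_assoc, Category.assoc,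
          pullback.lift_fst, pullback.lift_snd, Category.id_comp]
      · rw [Category.assoc, pullback.lift_snd, Category.assoc, pullback.lift_snd, pullback.lift_snd,
          pullback.lift_snd]
    exact Over.OverMorphism.ext key
  isLimit := Fork.IsLimit.mk' _ fun s => by
    let i : s.pt.left ⟶ pullback (X.hom ≫ k) k := s.ι.left
    have h0 : i ≫ pullback.lift (pullback.fst (X.hom ≫ k) k ≫ X.hom) (pullback.snd (X.hom ≫ k) k)
          (by rw [Category.assoc, pullback.condition]) =
        i ≫ pullback.lift (pullback.snd (X.hom ≫ k) k) (pullback.snd (X.hom ≫ k) k) rfl :=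
      congrArg (fun t => t.left) s.condition
    have hs : (i ≫ pullback.fst (X.hom ≫ k) k) ≫ X.hom = i ≫ pullback.snd (X.hom ≫ k) k := by
      have := congrArg (fun t => t ≫ pullback.fst k k) h0
      simpa only [Category.assoc, pullback.lift_fst] using this
    have hi : i ≫ pullback.snd (X.hom ≫ k) k = s.pt.hom := Over.w s.ι
    refine ⟨Over.homMk (i ≫ pullback.fst (X.hom ≫ k) k) (hs.trans hi), ?_, ?_⟩
    · have key : (i ≫ pullback.fst (X.hom ≫ k) k) ≫
          pullback.lift (f := X.hom ≫ k) (g := k) (𝟙 X.left) X.hom (Category.id_comp _) = i := by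
        apply pullback.hom_ext
        · rw [Category.assoc (i ≫ pullback.fst (X.hom ≫ k) k), pullback.lift_fst,
            Category.comp_id]
        · rw [Category.assoc (i ≫ pullback.fst (X.hom ≫ k) k), pullback.lift_snd, hs]
      exact Over.OverMorphism.ext key
    · intro m hm
      let j : s.pt.left ⟶ X.left := m.left
      have h1 : j ≫ pullback.lift (f := X.hom ≫ k) (g := k) (𝟙 X.left) X.hom
          (Category.id_comp _) = i := congrArg (fun t => t.left) hm
      have key : j = i ≫ pullback.fst (X.hom ≫ k) k := by
        rw [← h1, Category.assoc j, pullback.lift_fst, Category.comp_id]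
      exact Over.OverMorphism.ext key

theorem of_isPullback {B' B A' A : E} {k : B' ⟶ B} {f' : B' ⟶ A'} {f : B ⟶ A} {g : A' ⟶ A}
    (h : IsPullback k f' f g) (hf : IsExp f) : IsExp f' := by
  have : (Over.pullback f).IsLeftAdjoint := hf
  have : (Over.pullback f' ⋙ Over.map k).IsLeftAdjoint :=
    ((Adjunction.ofIsLeftAdjoint (Over.map g ⋙ Over.pullback f)).ofNatIsoLeft
      (baseChange h).symm).isLeftAdjoint
  have : HasFiniteLimits (Over A') := hasFiniteLimits_of_hasTerminal_and_pullbacks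
  exact isLeftAdjoint_triangle_lift (Over.pullback f') (Over.mapPullbackAdj k) (regularMonoUnit k)

end IsExp

/-- A polynomial in `E`: an exponentiable morphism `total ⟶ base`. -/
structure CatPoly (E : Type u) [Category.{v} E] [HasPullbacks E] where
  /-- the total space, or object of directions -/
  total : E
  /-- the base, or object of positions -/
  base : E
  /-- the morphism itself -/
  hom : total ⟶ base
  exp : IsExp hom

namespace CatPoly

section Category

variable {E : Type u} [Category.{v} E] [HasPullbacks E]

/-- A diagram representing a morphism of polynomials `p ⟶ q`: the right square is a pullback of
`q.hom` along `pos`, and `sharp` is a map over `p.base`.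
```
 p.total <--sharp-- apex --snd--> q.total
    |                |               |
    v                v fst           v
 p.base  ======== p.base --pos--> q.base
```
-/
structure Diagram (p q : CatPoly E) where
  pos : p.base ⟶ q.base
  apex : E
  fst : apex ⟶ p.base
  snd : apex ⟶ q.total
  isPullback : IsPullback fst snd pos q.hom
  sharp : apex ⟶ p.total
  sharp_hom : sharp ≫ p.hom = fst

namespace Diagram

/-- Two diagrams are isomorphic if they have the same component on positions and differ by an
isomorphism between the choices of pullback. -/
def Rel {p q : CatPoly E} (φ ψ : Diagram p q) : Prop :=
  φ.pos = ψ.pos ∧ ∃ e : φ.apex ≅ ψ.apex,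
    e.hom ≫ ψ.fst = φ.fst ∧ e.hom ≫ ψ.snd = φ.snd ∧ e.hom ≫ ψ.sharp = φ.sharp

theorem rel_equivalence (p q : CatPoly E) : Equivalence (Rel (p := p) (q := q)) where
  refl φ := ⟨rfl, Iso.refl _, by simp⟩
  symm := by
    rintro φ ψ ⟨h, e, h1, h2, h3⟩
    exact ⟨h.symm, e.symm, by simp [← h1], by simp [← h2], by simp [← h3]⟩
  trans := by
    rintro φ ψ χ ⟨h, e, h1, h2, h3⟩ ⟨h', e', h1', h2', h3'⟩
    exact ⟨h.trans h', e ≪≫ e', by simp [h1, h1'], by simp [h2, h2'], by simp [h3, h3']⟩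

/-- The isomorphism relation on diagrams. -/
instance setoid (p q : CatPoly E) : Setoid (Diagram p q) := ⟨Rel, rel_equivalence p q⟩

/-- The identity diagram. -/
def id (p : CatPoly E) : Diagram p p where
  pos := 𝟙 p.base
  apex := p.total
  fst := p.hom
  snd := 𝟙 p.total
  isPullback := IsPullback.of_id_snd
  sharp := 𝟙 p.total
  sharp_hom := Category.id_comp _

/-- The composite of two diagrams. Its apex is the pullback `p.base ×_{q.base} ψ.apex`, which is a
pullback of `r.hom` along `φ.pos ≫ ψ.pos`; its component on directions is `p.base ×_{q.base} ψ.sharp`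
followed by `φ.sharp`. -/
noncomputable def comp {p q r : CatPoly E} (φ : Diagram p q) (ψ : Diagram q r) : Diagram p r where
  pos := φ.pos ≫ ψ.pos
  apex := pullback φ.pos ψ.fst
  fst := pullback.fst _ _
  snd := pullback.snd _ _ ≫ ψ.snd
  isPullback := (IsPullback.of_hasPullback φ.pos ψ.fst).paste_vert ψ.isPullback
  sharp := φ.isPullback.lift (pullback.fst _ _) (pullback.snd _ _ ≫ ψ.sharp)
    (by rw [Category.assoc, ψ.sharp_hom, pullback.condition]) ≫ φ.sharp
  sharp_hom := by rw [Category.assoc, φ.sharp_hom, IsPullback.lift_fst]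

/-- The projection of the apex of a composite onto the apex of the first factor. -/
noncomputable def compLeft {p q r : CatPoly E} (φ : Diagram p q) (ψ : Diagram q r) :
    (φ.comp ψ).apex ⟶ φ.apex :=
  φ.isPullback.lift (pullback.fst _ _) (pullback.snd _ _ ≫ ψ.sharp)
    (pullback.condition.trans
      ((congrArg _ ψ.sharp_hom.symm).trans (Category.assoc _ _ _).symm))

/-- The projection of the apex of a composite onto the apex of the second factor. -/
noncomputable def compRight {p q r : CatPoly E} (φ : Diagram p q) (ψ : Diagram q r) :
    (φ.comp ψ).apex ⟶ ψ.apex :=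
  pullback.snd _ _

section

variable {p q r s : CatPoly E} (φ : Diagram p q) (ψ : Diagram q r) (χ : Diagram r s)

theorem compLeft_fst : compLeft φ ψ ≫ φ.fst = (φ.comp ψ).fst := IsPullback.lift_fst _ _ _ _

theorem compLeft_snd : compLeft φ ψ ≫ φ.snd = compRight φ ψ ≫ ψ.sharp :=
  IsPullback.lift_snd _ _ _ _

theorem compLeft_sharp : compLeft φ ψ ≫ φ.sharp = (φ.comp ψ).sharp := rfl

theorem compRight_fst : compRight φ ψ ≫ ψ.fst = (φ.comp ψ).fst ≫ φ.pos :=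
  pullback.condition.symm

theorem compRight_snd : compRight φ ψ ≫ ψ.snd = (φ.comp ψ).snd := rfl

theorem exists_lift_comp {X : E} (a : X ⟶ p.base) (b : X ⟶ ψ.apex) (h : a ≫ φ.pos = b ≫ ψ.fst) :
    ∃ l : X ⟶ (φ.comp ψ).apex, l ≫ (φ.comp ψ).fst = a ∧ l ≫ compRight φ ψ = b :=
  ⟨pullback.lift a b h, pullback.lift_fst _ _ _, pullback.lift_snd _ _ _⟩

variable {φ ψ χ}

theorem Rel.of_hom {φ' : Diagram p q} (h : φ.pos = φ'.pos) (e : φ.apex ⟶ φ'.apex)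
    (h1 : e ≫ φ'.fst = φ.fst) (h2 : e ≫ φ'.snd = φ.snd) (h3 : e ≫ φ'.sharp = φ.sharp) :
    Rel φ φ' := by
  have hp : IsPullback φ'.fst φ'.snd φ.pos q.hom := h ▸ φ'.isPullback
  have he : e = (φ.isPullback.isoIsPullback _ _ hp).hom := by
    apply hp.hom_ext
    · rw [IsPullback.isoIsPullback_hom_fst, h1]
    · rw [IsPullback.isoIsPullback_hom_snd, h2]
  subst he
  exact ⟨h, _, h1, h2, h3⟩

theorem comp_rel_of {χ : Diagram p r} (hpos : χ.pos = φ.pos ≫ ψ.pos) (a : χ.apex ⟶ φ.apex)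
    (b : χ.apex ⟶ ψ.apex) (ha : a ≫ φ.fst = χ.fst) (hab : a ≫ φ.snd = b ≫ ψ.sharp)
    (hb : b ≫ ψ.fst = χ.fst ≫ φ.pos) (hs : b ≫ ψ.snd = χ.snd) (h : a ≫ φ.sharp = χ.sharp) :
    Rel χ (φ.comp ψ) := by
  obtain ⟨l, h1, h2⟩ := exists_lift_comp φ ψ χ.fst b hb.symm
  have h3 : l ≫ compLeft φ ψ = a := by
    apply φ.isPullback.hom_ext
    · rw [Category.assoc, compLeft_fst, h1, ha]
    · rw [Category.assoc, compLeft_snd, reassoc_of% h2, hab]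
  refine Rel.of_hom hpos l h1 ?_ ?_
  · rw [← compRight_snd, reassoc_of% h2, hs]
  · rw [← compLeft_sharp, reassoc_of% h3, h]

theorem comp_rel {φ' : Diagram p q} {ψ' : Diagram q r}
    (h : Rel φ φ') (k : Rel ψ ψ') : Rel (φ.comp ψ) (φ'.comp ψ') := by
  obtain ⟨h0, e, h1, h2, h3⟩ := h
  obtain ⟨k0, d, k1, k2, k3⟩ := k
  refine comp_rel_of (by rw [← h0, ← k0]; rfl) (compLeft φ ψ ≫ e.hom) (compRight φ ψ ≫ d.hom)
    ?_ ?_ ?_ ?_ ?_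
  · rw [Category.assoc, h1, compLeft_fst]
  · rw [Category.assoc, Category.assoc, h2, k3, compLeft_snd]
  · rw [Category.assoc, k1, ← h0, compRight_fst]
  · rw [Category.assoc, k2, compRight_snd]
  · rw [Category.assoc, h3, compLeft_sharp]

theorem id_comp_rel (φ : Diagram p q) : Rel ((id p).comp φ) φ :=
  (rel_equivalence _ _).symm <| comp_rel_of (Category.id_comp _).symm φ.sharp (𝟙 _) φ.sharp_hom
    ((Category.comp_id _).trans (Category.id_comp _).symm)
    ((Category.id_comp _).trans (Category.comp_id _).symm) (Category.id_comp _) (Category.comp_id _)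

theorem comp_id_rel (φ : Diagram p q) : Rel (φ.comp (id q)) φ :=
  (rel_equivalence _ _).symm <| comp_rel_of (Category.comp_id _).symm (𝟙 _) φ.snd
    (Category.id_comp _) ((Category.id_comp _).trans (Category.comp_id _).symm)
    φ.isPullback.w.symm (Category.comp_id _) (Category.id_comp _)

theorem assoc_rel (φ : Diagram p q) (ψ : Diagram q r) (χ : Diagram r s) :
    Rel ((φ.comp ψ).comp χ) (φ.comp (ψ.comp χ)) := by
  have hl : (φ.comp ψ).pos = φ.pos ≫ ψ.pos := rfl
  obtain ⟨b, h1, h2⟩ := exists_lift_comp ψ χ (((φ.comp ψ).comp χ).fst ≫ φ.pos)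
    (compRight (φ.comp ψ) χ) (by rw [Category.assoc, ← hl, compRight_fst])
  have h3 : b ≫ compLeft ψ χ = compLeft (φ.comp ψ) χ ≫ compRight φ ψ := by
    apply ψ.isPullback.hom_ext
    · rw [Category.assoc, Category.assoc, compLeft_fst, compRight_fst, h1,
        ← Category.assoc, compLeft_fst]
    · rw [Category.assoc, Category.assoc, compLeft_snd, compRight_snd, compLeft_snd,
        reassoc_of% h2]
  refine comp_rel_of (Category.assoc _ _ _) (compLeft (φ.comp ψ) χ ≫ compLeft φ ψ) b ?_ ?_ h1 ?_ ?_
  · rw [Category.assoc, compLeft_fst, compLeft_fst]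
  · rw [Category.assoc, compLeft_snd, ← compLeft_sharp, reassoc_of% h3]
  · rw [← compRight_snd, reassoc_of% h2, compRight_snd]
  · rw [Category.assoc, compLeft_sharp, compLeft_sharp]

end

end Diagram

/-- Morphisms of polynomials are isomorphism classes of diagrams. -/
noncomputable instance category : Category (CatPoly E) where
  Hom p q := Quotient (Diagram.setoid p q)
  id p := Quotient.mk _ (Diagram.id p)
  comp := Quotient.map₂ Diagram.comp fun _ _ h _ _ k => Diagram.comp_rel h k
  id_comp := by
    rintro p q ⟨φ⟩
    exact Quotient.sound (Diagram.id_comp_rel φ)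
  comp_id := by
    rintro p q ⟨φ⟩
    exact Quotient.sound (Diagram.comp_id_rel φ)
  assoc := by
    rintro p q r s ⟨φ⟩ ⟨ψ⟩ ⟨χ⟩
    exact Quotient.sound (Diagram.assoc_rel φ ψ χ)

/-- The morphism represented by a diagram. -/
noncomputable def Diagram.toHom {p q : CatPoly E} (φ : Diagram p q) : p ⟶ q :=
  Quotient.mk (Diagram.setoid p q) φ

end Category

section Monoidal

variable {E : Type u} [Category.{v} E] [HasFiniteLimits E]

/-- The identity polynomial `y`: the identity of the terminal object. -/
noncomputable def y : CatPoly E where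
  total := ⊤_ E
  base := ⊤_ E
  hom := 𝟙 _
  exp := IsExp.id _

/-- The right adjoint `Π_p` of pullback along `p`. -/
noncomputable def push (p : CatPoly E) : Over p.total ⥤ Over p.base :=
  have : (Over.pullback p.hom).IsLeftAdjoint := p.exp
  (Over.pullback p.hom).rightAdjoint

/-- The adjunction between pullback along `p` and `Π_p`. -/
noncomputable def pushAdj (p : CatPoly E) : Over.pullback p.hom ⊣ p.push :=
  have : (Over.pullback p.hom).IsLeftAdjoint := p.exp
  Adjunction.ofIsLeftAdjoint (Over.pullback p.hom)

/-- The object `Π_p (Q × P_*)` over `P`, where `P_*` is the total space of `p`, `P` is the base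
of `p` and `Q` is the base of `q`. -/
noncomputable def dist (p q : CatPoly E) : Over p.base :=
  p.push.obj (Over.mk (prod.snd : q.base ⨯ p.total ⟶ p.total))

/-- The object `Π_p (Q × P_*) ×_P P_*`. -/
noncomputable abbrev mid (p q : CatPoly E) : E := pullback (p.dist q).hom p.hom

/-- The counit `Π_p (Q × P_*) ×_P P_* ⟶ Q × P_*`. -/
noncomputable def counit (p q : CatPoly E) : p.mid q ⟶ q.base ⨯ p.total :=
  (p.pushAdj.counit.app (Over.mk (prod.snd : q.base ⨯ p.total ⟶ p.total))).left

/-- The map `Π_p (Q × P_*) ×_P P_* ⟶ Q × P_* ⟶ Q`. -/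
noncomputable def ev (p q : CatPoly E) : p.mid q ⟶ q.base := p.counit q ≫ prod.fst

/-- The composition product of polynomials, given by the composite
`(Π_p (Q × P_*) ×_P P_*) ×_Q Q_* ⟶ Π_p (Q × P_*) ×_P P_* ⟶ Π_p (Q × P_*)`. -/
noncomputable def tri (p q : CatPoly E) : CatPoly E where
  total := pullback (p.ev q) q.hom
  base := (p.dist q).left
  hom := pullback.fst (p.ev q) q.hom ≫ pullback.fst (p.dist q).hom p.hom
  exp := IsExp.comp
    (IsExp.of_isPullback (IsPullback.of_hasPullback (p.ev q) q.hom).flip q.exp)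
    (IsExp.of_isPullback (IsPullback.of_hasPullback (p.dist q).hom p.hom).flip p.exp)

/-- The structure map `Π_p (Q × P_*) ⟶ P`. -/
noncomputable def triFst (p q : CatPoly E) : (p.tri q).base ⟶ p.base := (p.dist q).hom

/-- The projection `Π_p (Q × P_*) ×_P P_* ⟶ Π_p (Q × P_*)`. -/
noncomputable def midFst (p q : CatPoly E) : p.mid q ⟶ (p.tri q).base :=
  pullback.fst (p.dist q).hom p.hom

/-- The projection `Π_p (Q × P_*) ×_P P_* ⟶ P_*`. -/
noncomputable def midSnd (p q : CatPoly E) : p.mid q ⟶ p.total :=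
  pullback.snd (p.dist q).hom p.hom

/-- The projection `(p ◁ q)_* ⟶ Π_p (Q × P_*) ×_P P_*`. -/
noncomputable def totalFst (p q : CatPoly E) : (p.tri q).total ⟶ p.mid q :=
  pullback.fst (p.ev q) q.hom

/-- The projection `(p ◁ q)_* ⟶ Q_*`. -/
noncomputable def totalSnd (p q : CatPoly E) : (p.tri q).total ⟶ q.total :=
  pullback.snd (p.ev q) q.hom

theorem tri_hom (p q : CatPoly E) : (p.tri q).hom = p.totalFst q ≫ p.midFst q := rfl

theorem isPullback_midFst (p q : CatPoly E) :
    IsPullback (p.midFst q) (p.midSnd q) (p.triFst q) p.hom :=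
  IsPullback.of_hasPullback _ _

theorem isPullback_totalFst (p q : CatPoly E) :
    IsPullback (p.totalFst q) (p.totalSnd q) (p.ev q) q.hom :=
  IsPullback.of_hasPullback _ _

/-- For a pullback `U` of `p` along `b : X ⟶ P`, a map `u : U ⟶ Q` corresponds to a map
`U ⟶ Q × P_*` over `P_*`; its transpose is a map `X ⟶ Π_p (Q × P_*)` over `P`. -/
noncomputable def distLift {p : CatPoly E} (q : CatPoly E) {X U : E} {b : X ⟶ p.base} {f : U ⟶ X}
    {g : U ⟶ p.total} (h : IsPullback f g b p.hom) (u : U ⟶ q.base) :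
    Over.mk b ⟶ p.dist q :=
  p.pushAdj.homEquiv (Over.mk b) (Over.mk (prod.snd : q.base ⨯ p.total ⟶ p.total))
    (Over.homMk (prod.lift (h.lift (pullback.fst b p.hom) (pullback.snd b p.hom)
      pullback.condition ≫ u) (pullback.snd b p.hom)) (prod.lift_snd _ _))

theorem distLift_hom {p q : CatPoly E} {X U : E} {b : X ⟶ p.base} {f : U ⟶ X}
    {g : U ⟶ p.total} (h : IsPullback f g b p.hom) (u : U ⟶ q.base) :
    (distLift q h u).left ≫ (p.dist q).hom = b :=
  Over.w (distLift q h u)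

/-- The map `U ⟶ Π_p (Q × P_*) ×_P P_*` induced by `distLift`. -/
noncomputable def midLift {p : CatPoly E} (q : CatPoly E) {X U : E} {b : X ⟶ p.base} {f : U ⟶ X}
    {g : U ⟶ p.total} (h : IsPullback f g b p.hom) (u : U ⟶ q.base) : U ⟶ p.mid q :=
  pullback.lift (f ≫ (distLift q h u).left) g (by rw [Category.assoc, distLift_hom, h.w])

theorem counit_fst (p q : CatPoly E) : p.counit q ≫ prod.fst = p.ev q := rfl

theorem counit_snd (p q : CatPoly E) : p.counit q ≫ prod.snd = p.midSnd q :=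
  Over.w (p.pushAdj.counit.app (Over.mk (prod.snd : q.base ⨯ p.total ⟶ p.total)))

theorem map_counit {p q : CatPoly E} {X : E} {b : X ⟶ p.base} (s : Over.mk b ⟶ p.dist q) :
    ((p.pushAdj.homEquiv (Over.mk b) (Over.mk (prod.snd : q.base ⨯ p.total ⟶ p.total))).symm
      s).left = pullback.lift (f := (p.dist q).hom) (g := p.hom) (pullback.fst b p.hom ≫ s.left)
        (pullback.snd b p.hom)
        (by rw [Category.assoc, Over.w]; exact pullback.condition) ≫ p.counit q :=
  congrArg (fun t => t.left) (Adjunction.homEquiv_counit p.pushAdj (Over.mk b)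
    (Over.mk (prod.snd : q.base ⨯ p.total ⟶ p.total)) s)

theorem midLift_ev {p q : CatPoly E} {X U : E} {b : X ⟶ p.base} {f : U ⟶ X} {g : U ⟶ p.total}
    (h : IsPullback f g b p.hom) (u : U ⟶ q.base) : midLift q h u ≫ p.ev q = u := by
  have h1 : (p.pushAdj.homEquiv (Over.mk b) (Over.mk
      (prod.snd : q.base ⨯ p.total ⟶ p.total))).symm (distLift q h u) = _ :=
    Equiv.symm_apply_apply _ _
  have h2 : prod.lift (h.lift (pullback.fst b p.hom) (pullback.snd b p.hom)
      pullback.condition ≫ u) (pullback.snd b p.hom) = _ :=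
    (congrArg (fun t => t.left) h1).symm.trans (map_counit (distLift q h u))
  have h3 := congrArg (fun t => pullback.lift f g h.w ≫ t ≫ prod.fst) h2
  simp only [prod.lift_fst, Category.assoc] at h3
  have h4 : pullback.lift f g h.w ≫ h.lift (pullback.fst b p.hom) (pullback.snd b p.hom)
      pullback.condition = 𝟙 _ := by
    apply h.hom_ext
    · rw [Category.assoc, IsPullback.lift_fst, pullback.lift_fst, Category.id_comp]
    · rw [Category.assoc, IsPullback.lift_snd, pullback.lift_snd, Category.id_comp]
  rw [reassoc_of% h4, counit_fst] at h3
  refine Eq.trans ?_ h3.symm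
  rw [← Category.assoc]
  congr 1
  apply pullback.hom_ext
  · rw [midLift, pullback.lift_fst, Category.assoc, pullback.lift_fst, pullback.lift_fst_assoc]
  · rw [midLift, pullback.lift_snd, Category.assoc, pullback.lift_snd, pullback.lift_snd]

theorem dist_ext {p q : CatPoly E} {X U : E} {b : X ⟶ p.base} {f : U ⟶ X} {g : U ⟶ p.total}
    (h : IsPullback f g b p.hom) {s s' : X ⟶ (p.dist q).left} (hs : s ≫ (p.dist q).hom = b)
    (hs' : s' ≫ (p.dist q).hom = b) {m m' : U ⟶ p.mid q}
    (hm1 : m ≫ pullback.fst _ _ = f ≫ s) (hm2 : m ≫ pullback.snd _ _ = g)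
    (hm1' : m' ≫ pullback.fst _ _ = f ≫ s') (hm2' : m' ≫ pullback.snd _ _ = g)
    (e : m ≫ p.ev q = m' ≫ p.ev q) : s = s' := by
  have aux : ∀ (r : X ⟶ (p.dist q).left) (hr : r ≫ (p.dist q).hom = b) (n : U ⟶ p.mid q),
      n ≫ pullback.fst _ _ = f ≫ r → n ≫ pullback.snd _ _ = g →
      ((p.pushAdj.homEquiv (Over.mk b) (Over.mk (prod.snd : q.base ⨯ p.total ⟶ p.total))).symm
        (Over.homMk r hr : Over.mk b ⟶ p.dist q)).left =
      prod.lift (h.lift (pullback.fst b p.hom) (pullback.snd b p.hom) pullback.condition ≫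
        n ≫ p.ev q) (pullback.snd b p.hom) := by
    intro r hr n h1 h2
    refine (map_counit _).trans ?_
    have h3 : pullback.lift (f := (p.dist q).hom) (g := p.hom) (pullback.fst b p.hom ≫ r)
        (pullback.snd b p.hom) (by rw [Category.assoc, hr]; exact pullback.condition) =
        h.lift (pullback.fst b p.hom) (pullback.snd b p.hom) pullback.condition ≫ n := by
      apply pullback.hom_ext
      · rw [pullback.lift_fst, Category.assoc, h1, IsPullback.lift_fst_assoc]
      · rw [pullback.lift_snd, Category.assoc, h2, IsPullback.lift_snd]
    apply Limits.prod.hom_ext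
    · rw [prod.lift_fst]
      exact (Category.assoc _ _ _).trans
        ((congrArg (fun t => t ≫ p.ev q) h3).trans (Category.assoc _ _ _))
    · rw [prod.lift_snd]
      exact (Category.assoc _ _ _).trans
        ((congrArg _ (counit_snd p q)).trans (pullback.lift_snd _ _ _))
  have key : (Over.homMk s hs : Over.mk b ⟶ p.dist q) = Over.homMk s' hs' := by
    apply (p.pushAdj.homEquiv _ (Over.mk (prod.snd : q.base ⨯ p.total ⟶ p.total))).symm.injective
    apply Over.OverMorphism.ext
    refine (aux s hs m hm1 hm2).trans (Eq.trans ?_ (aux s' hs' m' hm1' hm2').symm)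
    rw [e]
  exact congrArg (fun k => k.left) key

/-- The data of a pullback of `p ◁ q` along a map out of `X`, in terms of `p` and `q`: both squares
are pullbacks.
```
  V --V_snd--> q.total
  |               |
  v V_fst         v
  U -----u-----> q.base      U --U_snd--> p.total
                             |               |
                             v U_fst         v
                             X -----b-----> p.base
```
-/
structure Shape (p q : CatPoly E) (X : E) where
  b : X ⟶ p.base
  U : E
  U_fst : U ⟶ X
  U_snd : U ⟶ p.total
  hU : IsPullback U_fst U_snd b p.hom
  u : U ⟶ q.base
  V : E
  V_fst : V ⟶ U
  V_snd : V ⟶ q.total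
  hV : IsPullback V_fst V_snd u q.hom

namespace Shape

variable {p q : CatPoly E} {X : E} (S : Shape p q X)

/-- The map on bases classifying the data. -/
noncomputable def toBase : X ⟶ (p.tri q).base := (distLift q S.hU S.u).left

theorem toTotal_aux : (S.V_fst ≫ midLift q S.hU S.u) ≫ p.ev q = S.V_snd ≫ q.hom := by
  rw [Category.assoc, midLift_ev, S.hV.w]

/-- The map induced on total spaces. -/
noncomputable def toTotal : S.V ⟶ (p.tri q).total :=
  pullback.lift (S.V_fst ≫ midLift q S.hU S.u) S.V_snd S.toTotal_aux

theorem isPullback_mid : IsPullback S.U_fst (midLift q S.hU S.u) S.toBase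
    (pullback.fst (p.dist q).hom p.hom) := by
  have h : IsPullback S.U_fst (midLift q S.hU S.u ≫ pullback.snd _ _)
      ((distLift q S.hU S.u).left ≫ (p.dist q).hom) p.hom := by
    rw [distLift_hom, midLift, pullback.lift_snd]
    exact S.hU
  exact h.of_bot (pullback.lift_fst _ _ _).symm (IsPullback.of_hasPullback _ _)

theorem isPullback_total : IsPullback S.V_fst S.toTotal (midLift q S.hU S.u)
    (pullback.fst (p.ev q) q.hom) := by
  have h : IsPullback S.V_fst (pullback.lift (S.V_fst ≫ midLift q S.hU S.u) S.V_snd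
      S.toTotal_aux ≫ pullback.snd _ _) (midLift q S.hU S.u ≫ p.ev q) q.hom := by
    rw [midLift_ev, pullback.lift_snd]
    exact S.hV
  exact h.of_bot (pullback.lift_fst _ _ _).symm (IsPullback.of_hasPullback _ _)

theorem isPullback : IsPullback (S.V_fst ≫ S.U_fst) S.toTotal S.toBase (p.tri q).hom :=
  S.isPullback_total.paste_horiz S.isPullback_mid

/-- Together with a map `V ⟶ m.total` over `m.base`, the data represent a morphism `m ⟶ p ◁ q`. -/
noncomputable def toDiagram {m : CatPoly E} (S : Shape p q m.base) (sharp : S.V ⟶ m.total)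
    (h : sharp ≫ m.hom = S.V_fst ≫ S.U_fst) : Diagram m (p.tri q) where
  pos := S.toBase
  apex := S.V
  fst := S.V_fst ≫ S.U_fst
  snd := S.toTotal
  isPullback := S.isPullback
  sharp := sharp
  sharp_hom := h

theorem toDiagram_rel {m : CatPoly E} {S S' : Shape p q m.base} {sharp : S.V ⟶ m.total}
    {h : sharp ≫ m.hom = S.V_fst ≫ S.U_fst} {sharp' : S'.V ⟶ m.total}
    {h' : sharp' ≫ m.hom = S'.V_fst ≫ S'.U_fst} (hb : S.b = S'.b) (e : S.U ⟶ S'.U)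
    (he1 : e ≫ S'.U_fst = S.U_fst) (he2 : e ≫ S'.U_snd = S.U_snd) (hu : e ≫ S'.u = S.u)
    (d : S.V ⟶ S'.V) (hd1 : d ≫ S'.V_fst = S.V_fst ≫ e) (hd2 : d ≫ S'.V_snd = S.V_snd)
    (hs : d ≫ sharp' = sharp) : Diagram.Rel (S.toDiagram sharp h) (S'.toDiagram sharp' h') := by
  have hbase : (distLift q S.hU S.u).left = (distLift q S'.hU S'.u).left := by
    refine dist_ext S.hU (distLift_hom _ _) ((distLift_hom _ _).trans hb.symm)
      (m := midLift q S.hU S.u) (m' := e ≫ midLift q S'.hU S'.u) ?_ ?_ ?_ ?_ ?_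
    · exact pullback.lift_fst _ _ _
    · exact pullback.lift_snd _ _ _
    · rw [Category.assoc, midLift, pullback.lift_fst, reassoc_of% he1]
    · rw [Category.assoc, midLift, pullback.lift_snd, he2]
    · rw [Category.assoc, midLift_ev, midLift_ev, hu]
  have hm : midLift q S.hU S.u = e ≫ midLift q S'.hU S'.u := by
    apply pullback.hom_ext
    · rw [midLift, midLift, pullback.lift_fst, Category.assoc, pullback.lift_fst, hbase,
        reassoc_of% he1]
    · rw [midLift, midLift, pullback.lift_snd, Category.assoc, pullback.lift_snd, he2]
  refine Diagram.Rel.of_hom hbase d ?_ ?_ hs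
  · show d ≫ S'.V_fst ≫ S'.U_fst = S.V_fst ≫ S.U_fst
    rw [reassoc_of% hd1, he1]
  · have hd : d ≫ pullback.lift (S'.V_fst ≫ midLift q S'.hU S'.u) S'.V_snd S'.toTotal_aux =
        pullback.lift (S.V_fst ≫ midLift q S.hU S.u) S.V_snd S.toTotal_aux := by
      apply pullback.hom_ext
      · rw [Category.assoc, pullback.lift_fst, pullback.lift_fst, hm, reassoc_of% hd1]
      · rw [Category.assoc, pullback.lift_snd, pullback.lift_snd, hd2]
    exact hd

end Shape

/-- The map `Π_p (Q × P_*) ×_P φ.apex ⟶ Π_p (Q × P_*) ×_P P_*` induced by `φ.sharp`. -/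
noncomputable def triMid {p p' q : CatPoly E} (φ : Diagram p p') :
    pullback (p.dist q).hom φ.fst ⟶ p.mid q :=
  pullback.lift (pullback.fst _ _) (pullback.snd _ _ ≫ φ.sharp)
    (by rw [Category.assoc, φ.sharp_hom, pullback.condition])

/-- The action of `◁` on representatives `φ : p ⟶ p'` and `ψ : q ⟶ q'`. On positions it is the map
`Π_p (Q × P_*) ⟶ Π_p' (Q' × P'_*)` over `φ.pos` transposed from
`Π_p (Q × P_*) ×_P' P'_* ⟶ Π_p (Q × P_*) ×_P P_* ⟶ Q ⟶ Q'`, given by `φ.sharp`, evaluation and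
`ψ.pos`; on directions it is given by `φ.sharp` and `ψ.sharp`. -/
noncomputable def triShape {p p' q q' : CatPoly E} (φ : Diagram p p') (ψ : Diagram q q') :
    Shape p' q' (p.tri q).base where
  b := (p.dist q).hom ≫ φ.pos
  U := pullback (p.dist q).hom φ.fst
  U_fst := pullback.fst _ _
  U_snd := pullback.snd _ _ ≫ φ.snd
  hU := (IsPullback.of_hasPullback (p.dist q).hom φ.fst).paste_vert φ.isPullback
  u := (triMid φ ≫ p.ev q) ≫ ψ.pos
  V := pullback (triMid φ ≫ p.ev q) ψ.fst
  V_fst := pullback.fst _ _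
  V_snd := pullback.snd _ _ ≫ ψ.snd
  hV := (IsPullback.of_hasPullback (triMid φ ≫ p.ev q) ψ.fst).paste_vert ψ.isPullback

theorem triSharp_aux {p p' q q' : CatPoly E} (φ : Diagram p p') (ψ : Diagram q q') :
    (pullback.fst (triMid φ ≫ p.ev q) ψ.fst ≫ triMid φ) ≫ p.ev q =
      (pullback.snd (triMid φ ≫ p.ev q) ψ.fst ≫ ψ.sharp) ≫ q.hom := by
  rw [Category.assoc, Category.assoc, ψ.sharp_hom, pullback.condition]

/-- The component on directions. -/
noncomputable def triSharp {p p' q q' : CatPoly E} (φ : Diagram p p') (ψ : Diagram q q') :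
    pullback (triMid φ ≫ p.ev q) ψ.fst ⟶ pullback (p.ev q) q.hom :=
  pullback.lift (pullback.fst (triMid φ ≫ p.ev q) ψ.fst ≫ triMid φ)
    (pullback.snd (triMid φ ≫ p.ev q) ψ.fst ≫ ψ.sharp) (triSharp_aux φ ψ)

/-- The composition product of representatives. -/
noncomputable def triDiagram {p p' q q' : CatPoly E} (φ : Diagram p p') (ψ : Diagram q q') :
    Diagram (p.tri q) (p'.tri q') :=
  (triShape φ ψ).toDiagram (triSharp φ ψ) <| by
    have h : triSharp φ ψ ≫ pullback.fst (p.ev q) q.hom ≫ pullback.fst (p.dist q).hom p.hom =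
        pullback.fst (triMid φ ≫ p.ev q) ψ.fst ≫ pullback.fst (p.dist q).hom φ.fst := by
      rw [triSharp, pullback.lift_fst_assoc, Category.assoc]
      exact congrArg _ (pullback.lift_fst _ _ _)
    exact h

theorem triDiagram_rel {p p' q q' : CatPoly E} {φ φ' : Diagram p p'} {ψ ψ' : Diagram q q'}
    (h : Diagram.Rel φ φ') (k : Diagram.Rel ψ ψ') :
    Diagram.Rel (triDiagram φ ψ) (triDiagram φ' ψ') := by
  obtain ⟨h0, e, h1, h2, h3⟩ := h
  obtain ⟨k0, d, k1, k2, k3⟩ := k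
  let E' : pullback (p.dist q).hom φ.fst ⟶ pullback (p.dist q).hom φ'.fst :=
    pullback.lift (pullback.fst _ _) (pullback.snd _ _ ≫ e.hom)
      (by rw [Category.assoc, h1, pullback.condition])
  have hE : E' ≫ triMid φ' = triMid (q := q) φ := by
    apply pullback.hom_ext
    · rw [Category.assoc, triMid, triMid, pullback.lift_fst, pullback.lift_fst, pullback.lift_fst]
    · rw [Category.assoc, triMid, triMid, pullback.lift_snd, pullback.lift_snd,
        pullback.lift_snd_assoc, Category.assoc, h3]
  let D' : pullback (triMid φ ≫ p.ev q) ψ.fst ⟶ pullback (triMid φ' ≫ p.ev q) ψ'.fst :=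
    pullback.lift (pullback.fst _ _ ≫ E') (pullback.snd _ _ ≫ d.hom)
      (by rw [Category.assoc, Category.assoc, reassoc_of% hE, k1, pullback.condition])
  have hD : D' ≫ triSharp φ' ψ' = triSharp φ ψ := by
    apply pullback.hom_ext
    · rw [Category.assoc, triSharp, triSharp, pullback.lift_fst, pullback.lift_fst,
        pullback.lift_fst_assoc, Category.assoc, hE]
    · rw [Category.assoc, triSharp, triSharp, pullback.lift_snd, pullback.lift_snd,
        pullback.lift_snd_assoc, Category.assoc, k3]
  refine Shape.toDiagram_rel ?_ E' ?_ ?_ ?_ D' ?_ ?_ ?_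
  · simp only [triShape, h0]
  · exact pullback.lift_fst _ _ _
  · show E' ≫ pullback.snd _ _ ≫ φ'.snd = pullback.snd _ _ ≫ φ.snd
    rw [pullback.lift_snd_assoc, Category.assoc, h2]
  · show E' ≫ (triMid φ' ≫ p.ev q) ≫ ψ'.pos = (triMid φ ≫ p.ev q) ≫ ψ.pos
    rw [Category.assoc, reassoc_of% hE, Category.assoc, k0]
  · exact pullback.lift_fst _ _ _
  · show D' ≫ pullback.snd _ _ ≫ ψ'.snd = pullback.snd _ _ ≫ ψ.snd
    rw [pullback.lift_snd_assoc, Category.assoc, k2]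
  · exact hD

/-- The composition product of morphisms of polynomials. -/
noncomputable def triHom {p p' q q' : CatPoly E} :
    (p ⟶ p') → (q ⟶ q') → (p.tri q ⟶ p'.tri q') :=
  Quotient.map₂ triDiagram fun _ _ h _ _ k => triDiagram_rel h k

/-- The inverse of the projection `Π_y (P × 1) ×_1 1 ⟶ Π_y (P × 1)`. -/
noncomputable def leftSection (p : CatPoly E) : (y.tri p).base ⟶ y.mid p :=
  (isPullback_midFst y p).lift (𝟙 _) (y.triFst p)
    ((Category.id_comp _).trans (Category.comp_id _).symm)

theorem leftSection_fst (p : CatPoly E) : leftSection p ≫ y.midFst p = 𝟙 _ :=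
  IsPullback.lift_fst _ _ _ _

theorem fst_leftSection (p : CatPoly E) : y.midFst p ≫ leftSection p = 𝟙 _ := by
  apply (isPullback_midFst y p).hom_ext
  · rw [Category.assoc, leftSection_fst, Category.comp_id, Category.id_comp]
  · exact Subsingleton.elim (α := y.mid p ⟶ ⊤_ E) _ _

theorem leftUnitor_isPullback (p : CatPoly E) :
    IsPullback (y.tri p).hom (y.totalSnd p) (leftSection p ≫ y.ev p) p.hom := by
  have : IsIso (leftSection p) := ⟨_, leftSection_fst p, fst_leftSection p⟩
  have h : IsPullback (y.tri p).hom (𝟙 _) (leftSection p) (y.totalFst p) :=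
    IsPullback.of_vert_isIso
      ⟨by rw [tri_hom, Category.assoc, fst_leftSection, Category.comp_id, Category.id_comp]⟩
  simpa using h.paste_vert (isPullback_totalFst y p)

/-- The left unitor `y ◁ p ⟶ p`: on positions it is evaluation
`Π_y (P × 1) ≅ Π_y (P × 1) ×_1 1 ⟶ P`, and it is cartesian. -/
noncomputable def leftUnitorDiagram (p : CatPoly E) : Diagram (y.tri p) p where
  pos := leftSection p ≫ y.ev p
  apex := (y.tri p).total
  fst := (y.tri p).hom
  snd := y.totalSnd p
  isPullback := leftUnitor_isPullback p
  sharp := 𝟙 _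
  sharp_hom := Category.id_comp _

theorem rightUnitor_isPullback (p : CatPoly E) :
    IsPullback (p.tri y).hom (p.totalFst y ≫ p.midSnd y) (p.triFst y) p.hom := by
  have : IsIso (y : CatPoly E).hom := inferInstanceAs (IsIso (𝟙 (⊤_ E)))
  have : IsIso (p.totalFst y) := (isPullback_totalFst p y).isIso_fst_of_isIso
  have h : IsPullback (p.tri y).hom (p.totalFst y) (𝟙 _) (p.midFst y) :=
    IsPullback.of_vert_isIso ⟨by rw [tri_hom, Category.comp_id]⟩
  simpa using h.paste_vert (isPullback_midFst p y)

/-- The right unitor `p ◁ y ⟶ p`: on positions it is the structure map `Π_p (1 × P_*) ⟶ P`, and it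
is cartesian. -/
noncomputable def rightUnitorDiagram (p : CatPoly E) : Diagram (p.tri y) p where
  pos := p.triFst y
  apex := (p.tri y).total
  fst := (p.tri y).hom
  snd := p.totalFst y ≫ p.midSnd y
  isPullback := rightUnitor_isPullback p
  sharp := 𝟙 _
  sharp_hom := Category.id_comp _

/-- The pullback `U` of `p` along `((p ◁ q) ◁ r).base ⟶ (p ◁ q).base ⟶ p.base`. -/
noncomputable abbrev assocMid (p q r : CatPoly E) : E :=
  pullback ((p.tri q).triFst r) (p.midFst q)

/-- The map from `((p ◁ q) ◁ r).base ×_{(p ◁ q).base} (p ◁ q)_*` to `assocMid`. -/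
noncomputable def assocProj (p q r : CatPoly E) : (p.tri q).mid r ⟶ assocMid p q r :=
  pullback.lift ((p.tri q).midFst r) ((p.tri q).midSnd r ≫ p.totalFst q)
    (by rw [Category.assoc, ← tri_hom, (isPullback_midFst (p.tri q) r).w])

theorem assocInner_isPullback (p q r : CatPoly E) :
    IsPullback (assocProj p q r) ((p.tri q).midSnd r ≫ p.totalSnd q)
      (pullback.snd ((p.tri q).triFst r) (p.midFst q) ≫ p.ev q) q.hom := by
  have h : IsPullback (assocProj p q r ≫ pullback.fst _ _) ((p.tri q).midSnd r)
      ((p.tri q).triFst r) (p.totalFst q ≫ p.midFst q) := by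
    rw [assocProj, pullback.lift_fst, ← tri_hom]
    exact isPullback_midFst (p.tri q) r
  exact (h.of_right (pullback.lift_snd _ _ _) (IsPullback.of_hasPullback _ _)).paste_vert
    (isPullback_totalFst p q)

/-- The pullback of `q ◁ r` along the map `assocMid p q r ⟶ (q ◁ r).base` which is evaluation
`Π_p (Q × P_*) ×_P P_* ⟶ Q` together with evaluation for `p ◁ q` and `r`. -/
noncomputable def assocInner (p q r : CatPoly E) : Shape q r (assocMid p q r) where
  b := pullback.snd ((p.tri q).triFst r) (p.midFst q) ≫ p.ev q
  U := (p.tri q).mid r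
  U_fst := assocProj p q r
  U_snd := (p.tri q).midSnd r ≫ p.totalSnd q
  hU := assocInner_isPullback p q r
  u := (p.tri q).ev r
  V := ((p.tri q).tri r).total
  V_fst := (p.tri q).totalFst r
  V_snd := (p.tri q).totalSnd r
  hV := isPullback_totalFst (p.tri q) r

/-- The pullback of `p ◁ (q ◁ r)` along the component of the associator on positions. -/
noncomputable def assocShape (p q r : CatPoly E) :
    Shape p (q.tri r) ((p.tri q).tri r).base where
  b := (p.tri q).triFst r ≫ p.triFst q
  U := assocMid p q r
  U_fst := pullback.fst _ _
  U_snd := pullback.snd ((p.tri q).triFst r) (p.midFst q) ≫ p.midSnd q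
  hU := (IsPullback.of_hasPullback _ _).paste_vert (isPullback_midFst p q)
  u := (assocInner p q r).toBase
  V := ((p.tri q).tri r).total
  V_fst := (p.tri q).totalFst r ≫ assocProj p q r
  V_snd := (assocInner p q r).toTotal
  hV := (assocInner p q r).isPullback

/-- The associator `(p ◁ q) ◁ r ⟶ p ◁ (q ◁ r)`; it is cartesian. -/
noncomputable def assocDiagram (p q r : CatPoly E) :
    Diagram ((p.tri q).tri r) (p.tri (q.tri r)) :=
  (assocShape p q r).toDiagram (𝟙 ((p.tri q).tri r).total) <| by
    have h : ((p.tri q).totalFst r ≫ assocProj p q r) ≫ pullback.fst _ _ =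
        ((p.tri q).tri r).hom := by
      rw [Category.assoc, assocProj, pullback.lift_fst, tri_hom (p.tri q) r]
    exact (Category.id_comp _).trans h.symm

end Monoidal

end CatPoly

/-! ### Pullbacks of polynomials and their base change -/

namespace CatPoly

variable {E : Type u} [Category.{v} E]

/-! The proof works with generalized elements. A `Step p X` is a position of `p` at stage `X`
together with a chosen object of directions. The universal property of `Π_p` says that a step of `p
◁ q` over `X` is the same as a step `S` of `p` over `X` followed by a step `T` of `q` over the
directions `S.U`: `Step.exists_mid` and `Step.tri_eq` give existence and uniqueness of the
classifying data, and `Step.exists_eq_tri` gives the decomposition.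

A morphism `φ : p ⟶ p'` carries steps of `p` to steps of `p'`, with a map backwards on directions.
Since pullbacks are unique only up to isomorphism, this is a relation `Acts` and not a function. By
`Acts.hom_ext`, evaluated at the universal step, a morphism is determined by its action. The
relation allows a change of base `x : X' ⟶ X` because the second component of a pair lives over the
directions of the first, and these change when `φ` acts.

On decomposed steps all the structure becomes elementary. `Acts.tri` says that `φ ◁ ψ` acts
componentwise, `Acts.associator` that the associator turns `((S, T), W)` into `(S, (T, W))` with the
identity on directions, and `Acts.leftUnitor` and `Acts.rightUnitor` that the unitors discard a step
of `y`, whose projection is invertible. Functoriality, naturality, pentagon and triangle follow by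
tracing a decomposed step along both sides; the inverses of the structure maps come from performing
the reverse operation on a universal step. -/

/-- A pullback of the polynomial `p` along a map out of `X`. -/
structure Step [HasPullbacks E] (p : CatPoly E) (X : E) where
  b : X ⟶ p.base
  U : E
  fst : U ⟶ X
  snd : U ⟶ p.total
  isPullback : IsPullback fst snd b p.hom

/-- `c` exhibits `S'` as the base change of `S` along `x`. -/
structure Step.BaseChange [HasPullbacks E] {p : CatPoly E} {X X' : E} (S : Step p X)
    (S' : Step p X') (x : X' ⟶ X) (c : S'.U ⟶ S.U) : Prop where
  b : S'.b = x ≫ S.b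
  fst : c ≫ S.fst = S'.fst ≫ x
  snd : c ≫ S.snd = S'.snd

namespace Step

section Pullbacks

variable [HasPullbacks E] {p : CatPoly E} {X X' X'' : E}

/-- The polynomial itself, as a pullback along the identity. -/
def univ (p : CatPoly E) : Step p p.base where
  b := 𝟙 _
  U := p.total
  fst := p.hom
  snd := 𝟙 _
  isPullback := IsPullback.of_id_snd

/-- Lets a morphism built from data over `univ p` be evaluated on every step. -/
theorem baseChange_univ (S : Step p X) : (univ p).BaseChange S S.b S.snd where
  b := (Category.comp_id _).symm
  fst := S.isPullback.w.symm
  snd := Category.comp_id _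

namespace BaseChange

theorem comp {S : Step p X} {S' : Step p X'} {S'' : Step p X''} {x : X' ⟶ X} {x' : X'' ⟶ X'}
    {c : S'.U ⟶ S.U} {c' : S''.U ⟶ S'.U} (h : S.BaseChange S' x c) (h' : S'.BaseChange S'' x' c') :
    S.BaseChange S'' (x' ≫ x) (c' ≫ c) where
  b := by rw [h'.b, h.b, Category.assoc]
  fst := by rw [Category.assoc, h.fst, reassoc_of% h'.fst]
  snd := by rw [Category.assoc, h.snd, h'.snd]

theorem refl (S : Step p X) : S.BaseChange S (𝟙 _) (𝟙 _) where
  b := (Category.id_comp _).symm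
  fst := (Category.id_comp _).trans (Category.comp_id _).symm
  snd := Category.id_comp _

end BaseChange

theorem exists_baseChange (S : Step p X) (x : X' ⟶ X) :
    ∃ (S' : Step p X') (c : S'.U ⟶ S.U), S.BaseChange S' x c :=
  ⟨⟨x ≫ S.b, pullback x S.fst, pullback.fst _ _, pullback.snd _ _ ≫ S.snd,
    (IsPullback.of_hasPullback x S.fst).paste_vert S.isPullback⟩, pullback.snd _ _,
    rfl, pullback.condition.symm, rfl⟩

end Pullbacks

/-! ### Steps of a composition product as pairs of steps -/

variable [HasFiniteLimits E] {p q r : CatPoly E} {X X' : E}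

/-- The data of `S` and `T` as a `Shape`. -/
abbrev shape (S : Step p X) (T : Step q S.U) : Shape p q X where
  b := S.b
  U := S.U
  U_fst := S.fst
  U_snd := S.snd
  hU := S.isPullback
  u := T.b
  V := T.U
  V_fst := T.fst
  V_snd := T.snd
  hV := T.isPullback

/-- Pullbacks of `p` and `q` combine to a pullback of `p ◁ q`. -/
noncomputable abbrev tri (S : Step p X) (T : Step q S.U) : Step (p.tri q) X where
  b := (S.shape T).toBase
  U := T.U
  fst := T.fst ≫ S.fst
  snd := (S.shape T).toTotal
  isPullback := (S.shape T).isPullback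

/-- The universal pullback of `p` in `p ◁ q`. -/
noncomputable abbrev outer (p q : CatPoly E) : Step p (p.tri q).base where
  b := p.triFst q
  U := p.mid q
  fst := p.midFst q
  snd := p.midSnd q
  isPullback := isPullback_midFst p q

/-- The universal pullback of `q` in `p ◁ q`. -/
noncomputable abbrev inner (p q : CatPoly E) : Step q (p.mid q) where
  b := p.ev q
  U := (p.tri q).total
  fst := p.totalFst q
  snd := p.totalSnd q
  isPullback := isPullback_totalFst p q

/-- Existence half of the universal property of `Π_p`: the witness `m` is the map of middle objects
over the classifying map, and `ev` along it recovers `T.b`. -/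
theorem exists_mid (S : Step p X) (T : Step q S.U) : ∃ m : S.U ⟶ p.mid q,
    (outer p q).BaseChange S (S.tri T).b m ∧ (inner p q).BaseChange T m (S.tri T).snd := by
  refine ⟨midLift q S.isPullback T.b, ⟨(distLift_hom _ _).symm, pullback.lift_fst _ _ _,
    pullback.lift_snd _ _ _⟩, ⟨(midLift_ev _ _).symm, pullback.lift_fst _ _ _,
    pullback.lift_snd _ _ _⟩⟩

/-- Uniqueness half: `dist_ext` pins down the map to `Π_p`, and then the maps to the two pullbacks
over it are forced. -/
theorem tri_eq (S : Step p X) (T : Step q S.U) {s : X ⟶ (p.tri q).base} {m : S.U ⟶ p.mid q}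
    {n : T.U ⟶ (p.tri q).total} (h : (outer p q).BaseChange S s m)
    (k : (inner p q).BaseChange T m n) : (S.tri T).b = s ∧ (S.tri T).snd = n := by
  obtain ⟨m', h', k'⟩ := exists_mid S T
  have hs : (S.tri T).b = s := dist_ext S.isPullback h'.b.symm h.b.symm h'.fst h'.snd h.fst h.snd
    (k'.b.symm.trans k.b)
  have hm : m' = m := (isPullback_midFst p q).hom_ext
    (h'.fst.trans ((congrArg _ hs).trans h.fst.symm)) (h'.snd.trans h.snd.symm)
  refine ⟨hs, (isPullback_totalFst p q).hom_ext ?_ (k'.snd.trans k.snd.symm)⟩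
  exact k'.fst.trans ((congrArg _ hm).trans k.fst.symm)

/-- The pair `(S', T')` is a base change of the universal pair by way of `(S, T)`, so uniqueness
identifies its classifying map. -/
theorem BaseChange.tri {S : Step p X} {T : Step q S.U} {S' : Step p X'} {T' : Step q S'.U}
    {x : X' ⟶ X} {c : S'.U ⟶ S.U} {d : T'.U ⟶ T.U} (h : S.BaseChange S' x c)
    (k : T.BaseChange T' c d) : (S.tri T).BaseChange (S'.tri T') x d := by
  obtain ⟨m, hm, km⟩ := exists_mid S T
  obtain ⟨hb, hs⟩ := tri_eq S' T' (hm.comp h) (km.comp k)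
  refine ⟨hb, ?_, hs.symm⟩
  show d ≫ T.fst ≫ S.fst = (T'.fst ≫ S'.fst) ≫ x
  rw [reassoc_of% k.fst, h.fst, Category.assoc]

/-- Converse of `BaseChange.tri`. The map `c` is forced by the pullback `S.U`, and it commutes with
the maps to the middle object, from which the conditions on `T` and `T'` are read off. -/
theorem BaseChange.exists_of_tri {S : Step p X} {T : Step q S.U} {S' : Step p X'}
    {T' : Step q S'.U} {x : X' ⟶ X} {d : T'.U ⟶ T.U} (h : (S.tri T).BaseChange (S'.tri T') x d) :
    ∃ c, S.BaseChange S' x c ∧ T.BaseChange T' c d := by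
  obtain ⟨m, hm, km⟩ := exists_mid S T
  obtain ⟨m', hm', km'⟩ := exists_mid S' T'
  have hb : S'.b = x ≫ S.b := by rw [hm'.b, hm.b, h.b, Category.assoc]
  obtain ⟨c, hc1, hc2⟩ : ∃ c : S'.U ⟶ S.U, c ≫ S.fst = S'.fst ≫ x ∧ c ≫ S.snd = S'.snd := by
    refine ⟨S.isPullback.lift (S'.fst ≫ x) S'.snd ?_, S.isPullback.lift_fst _ _ _,
      S.isPullback.lift_snd _ _ _⟩
    rw [Category.assoc, ← hb, S'.isPullback.w]
  have hc : c ≫ m = m' := by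
    refine (isPullback_midFst p q).hom_ext ?_ ?_
    · refine Eq.trans ?_ hm'.fst.symm
      rw [Category.assoc, h.b, ← reassoc_of% hc1]
      exact congrArg _ hm.fst
    · refine Eq.trans ?_ hm'.snd.symm
      rw [Category.assoc, ← hc2]
      exact congrArg _ hm.snd
  refine ⟨c, ⟨hb, hc1, hc2⟩, ?_, ?_, ?_⟩
  · rw [km'.b, km.b, ← hc, Category.assoc]
  · apply S.isPullback.hom_ext
    · rw [Category.assoc, Category.assoc, hc1, ← Category.assoc T'.fst]
      exact h.fst
    · rw [Category.assoc, Category.assoc, hc2, ← hm.snd, ← hm'.snd, ← reassoc_of% km.fst,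
        ← reassoc_of% km'.fst]
      exact (reassoc_of% h.snd) _
  · rw [← km.snd, ← km'.snd, ← h.snd, Category.assoc]

theorem mk_congr {U : E} {b b' : X ⟶ p.base} {f f' : U ⟶ X} {g g' : U ⟶ p.total}
    (h : IsPullback f g b p.hom) (h' : IsPullback f' g' b' p.hom) (hb : b = b') (hf : f = f')
    (hg : g = g') : (⟨b, U, f, g, h⟩ : Step p X) = ⟨b', U, f', g', h'⟩ := by
  subst hb hf hg
  rfl

/-- An equality, not just an isomorphism, can be had because `S.U` itself is kept as the directions
of the second step. Later proofs can therefore replace any step of `p ◁ q` by a pair. -/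
theorem exists_eq_tri (S : Step (p.tri q) X) :
    ∃ (S₁ : Step p X) (S₂ : Step q S₁.U), S = S₁.tri S₂ := by
  obtain ⟨b, U, f, g, h⟩ := S
  have hm := IsPullback.of_hasPullback b (p.midFst q)
  let l : U ⟶ pullback b (p.midFst q) :=
    pullback.lift f (g ≫ p.totalFst q) (by rw [h.w, tri_hom, Category.assoc])
  have hl1 : l ≫ pullback.fst _ _ = f := pullback.lift_fst _ _ _
  have hl2 : l ≫ pullback.snd _ _ = g ≫ p.totalFst q := pullback.lift_snd _ _ _
  have h' : IsPullback (l ≫ pullback.fst _ _) g b (p.totalFst q ≫ p.midFst q) := by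
    rw [hl1]
    exact h
  let S₁ : Step p X := ⟨b ≫ p.triFst q, _, pullback.fst _ _, pullback.snd _ _ ≫ p.midSnd q,
    hm.paste_vert (isPullback_midFst p q)⟩
  -- Cancelling the pullback `hm` from the rectangle `h'` makes `l` a pullback of `p.totalFst q`.
  let S₂ : Step q S₁.U := ⟨pullback.snd _ _ ≫ p.ev q, U, l, g ≫ p.totalSnd q,
    (h'.of_right hl2 hm).paste_vert (isPullback_totalFst p q)⟩
  have h₁ : (outer p q).BaseChange S₁ b (pullback.snd _ _) := ⟨rfl, hm.w.symm, rfl⟩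
  have h₂ : (inner p q).BaseChange S₂ (pullback.snd _ _) g := ⟨rfl, hl2.symm, rfl⟩
  obtain ⟨hb, hs⟩ := tri_eq S₁ S₂ h₁ h₂
  exact ⟨S₁, S₂, mk_congr _ _ hb.symm hl1.symm hs.symm⟩

end Step

end CatPoly

/-! ### The action of morphisms on steps -/

namespace CatPoly

variable {E : Type u} [Category.{v} E]

section Pullbacks

variable [HasPullbacks E] {p p' p'' : CatPoly E} {X X' X'' : E}

/-- The diagram `φ` carries the pullback `S` of `p` along `S.b` to the pullback `S'` of `p'` along
`x ≫ S.b ≫ φ.pos`, and `c` is the map induced on directions. -/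
structure Diagram.Acts (φ : Diagram p p') (S : Step p X) (S' : Step p' X') (x : X' ⟶ X)
    (c : S'.U ⟶ S.U) (a : S'.U ⟶ φ.apex) : Prop where
  b : S'.b = x ≫ S.b ≫ φ.pos
  fst : c ≫ S.fst = S'.fst ≫ x
  apex_fst : a ≫ φ.fst = S'.fst ≫ x ≫ S.b
  apex_snd : a ≫ φ.snd = S'.snd
  sharp : a ≫ φ.sharp = c ≫ S.snd

/-- The morphism `φ` carries `S` to `S'`, with `c` the map induced on directions. -/
def Acts (φ : p ⟶ p') (S : Step p X) (S' : Step p' X') (x : X' ⟶ X) (c : S'.U ⟶ S.U) : Prop :=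
  ∃ (φ₀ : Diagram p p') (a : S'.U ⟶ φ₀.apex), φ₀.toHom = φ ∧ φ₀.Acts S S' x c a

namespace Acts

/-- The representative hidden in `Acts` may be replaced by any other, by transporting the map to the
apex along the isomorphism of apexes. -/
theorem exists_of_toHom {φ : Diagram p p'} {S : Step p X} {S' : Step p' X'} {x : X' ⟶ X}
    {c : S'.U ⟶ S.U} (h : Acts φ.toHom S S' x c) : ∃ a, φ.Acts S S' x c a := by
  obtain ⟨φ₀, a, e, h⟩ := h
  obtain ⟨h0, i, h1, h2, h3⟩ := Quotient.exact e
  refine ⟨a ≫ i.hom, ?_, h.fst, ?_, ?_, ?_⟩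
  · rw [← h0, h.b]
  · rw [Category.assoc, h1, h.apex_fst]
  · rw [Category.assoc, h2, h.apex_snd]
  · rw [Category.assoc, h3, h.sharp]

/-- The action of a diagram, from its action on the universal pullback. -/
theorem of_diagram {φ : Diagram p p'} {S : Step p X} {S' : Step p' X'} {x : X' ⟶ X}
    {c : S'.U ⟶ S.U} {n : S'.U ⟶ φ.apex}
    (h : Step.BaseChange ⟨φ.pos, φ.apex, φ.fst, φ.snd, φ.isPullback⟩ S' (x ≫ S.b) n)
    (hc : c ≫ S.fst = S'.fst ≫ x) (hn : n ≫ φ.sharp = c ≫ S.snd) : Acts φ.toHom S S' x c := by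
  refine ⟨φ, n, rfl, ?_, hc, h.fst, h.snd, hn⟩
  rw [h.b, Category.assoc]

theorem exists_acts_id (φ : p ⟶ p') (S : Step p X) : ∃ S' c, Acts φ S S' (𝟙 X) c := by
  obtain ⟨φ, rfl⟩ := Quotient.exists_rep φ
  let S' : Step p' X := ⟨S.b ≫ φ.pos, pullback S.b φ.fst, pullback.fst _ _,
    pullback.snd _ _ ≫ φ.snd, (IsPullback.of_hasPullback _ _).paste_vert φ.isPullback⟩
  refine ⟨S', S.isPullback.lift (pullback.fst _ _) (pullback.snd _ _ ≫ φ.sharp) ?_, φ,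
    pullback.snd _ _, rfl, ?_, ?_, ?_, rfl, ?_⟩
  · rw [Category.assoc, φ.sharp_hom, pullback.condition]
  · exact (Category.id_comp _).symm
  · exact (S.isPullback.lift_fst _ _ _).trans (Category.comp_id _).symm
  · rw [Category.id_comp]
    exact pullback.condition.symm
  · exact (S.isPullback.lift_snd _ _ _).symm

/-- The map to the apex of the composite is induced by the one for `ψ`; its projection to the apex
of `φ` is then the one for `φ` precomposed with `c'`. -/
theorem comp_of_hom {φ : p ⟶ p'} {ψ : p' ⟶ p''} {S : Step p X} {S' : Step p' X'}
    {S'' : Step p'' X''} {x : X' ⟶ X} {x' : X'' ⟶ X'} {c : S'.U ⟶ S.U} {c' : S''.U ⟶ S'.U}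
    (h : Acts φ S S' x c) (k : Acts ψ S' S'' x' c') :
    Acts (φ ≫ ψ) S S'' (x' ≫ x) (c' ≫ c) := by
  obtain ⟨φ, a, rfl, h⟩ := h
  obtain ⟨ψ, a', rfl, k⟩ := k
  obtain ⟨l, h1, h2⟩ := Diagram.exists_lift_comp φ ψ (S''.fst ≫ x' ≫ x ≫ S.b) a'
    (by rw [k.apex_fst, h.b, Category.assoc, Category.assoc, Category.assoc])
  have hl : l ≫ Diagram.compLeft φ ψ = c' ≫ a := by
    apply φ.isPullback.hom_ext
    · rw [Category.assoc, Category.assoc, Diagram.compLeft_fst, h1, h.apex_fst,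
        reassoc_of% k.fst]
    · rw [Category.assoc, Category.assoc, Diagram.compLeft_snd, reassoc_of% h2, h.apex_snd, k.sharp]
  refine ⟨φ.comp ψ, l, rfl, ?_, ?_, ?_, ?_, ?_⟩
  · rw [k.b, h.b, Category.assoc, Category.assoc, Category.assoc]
    rfl
  · rw [Category.assoc, h.fst, reassoc_of% k.fst]
  · rw [h1, Category.assoc]
  · rw [← Diagram.compRight_snd, reassoc_of% h2, k.apex_snd]
  · rw [← Diagram.compLeft_sharp, reassoc_of% hl, h.sharp, Category.assoc]

theorem comp {φ : p ⟶ p'} {ψ : p' ⟶ p''} {S : Step p X} {S' : Step p' X} {S'' : Step p'' X}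
    {c : S'.U ⟶ S.U} {c' : S''.U ⟶ S'.U} (h : Acts φ S S' (𝟙 X) c) (k : Acts ψ S' S'' (𝟙 X) c') :
    Acts (φ ≫ ψ) S S'' (𝟙 X) (c' ≫ c) := by
  simpa using h.comp_of_hom k

/-- Different choices of pullback are thus related by the identity morphism, which absorbs all
bookkeeping of such choices. -/
theorem id_iff {S : Step p X} {S' : Step p X'} {x : X' ⟶ X} {c : S'.U ⟶ S.U} :
    Acts (𝟙 p) S S' x c ↔ S.BaseChange S' x c := by
  constructor
  · intro h
    obtain ⟨a, h⟩ := exists_of_toHom (φ := Diagram.id p) h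
    refine ⟨?_, h.fst, ?_⟩
    · rw [h.b]
      exact congrArg _ (Category.comp_id _)
    · exact h.sharp.symm.trans h.apex_snd
  · intro h
    refine ⟨Diagram.id p, S'.snd, rfl, ?_, h.fst, ?_, Category.comp_id _, ?_⟩
    · rw [h.b]
      exact congrArg _ (Category.comp_id _).symm
    · rw [← h.b]
      exact S'.isPullback.w.symm
    · exact (Category.comp_id _).trans h.snd.symm

/-- The action is natural in the stage: the results `S'` and `T'` are both pulled back from the apex
of `φ`, so a base change between the inputs induces one between the outputs. -/
theorem _root_.CatPoly.Diagram.Acts.exists_baseChange {φ : Diagram p p'} {Y Y' : E} {S : Step p X}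
    {S' : Step p' X'} {T : Step p Y} {T' : Step p' Y'} {x : X' ⟶ X} {y : Y' ⟶ Y} {z : Y ⟶ X}
    {z' : Y' ⟶ X'} {c : S'.U ⟶ S.U} {d : T'.U ⟶ T.U} {m : T.U ⟶ S.U} {a : S'.U ⟶ φ.apex}
    {b : T'.U ⟶ φ.apex} (h : φ.Acts S S' x c a) (k : φ.Acts T T' y d b) (e : S.BaseChange T z m)
    (w : z' ≫ x = y ≫ z) : ∃ n : T'.U ⟶ S'.U, S'.BaseChange T' z' n ∧ n ≫ c = d ≫ m := by
  have hb : T'.b = z' ≫ S'.b := by rw [k.b, h.b, e.b, reassoc_of% w, Category.assoc]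
  obtain ⟨n, hn1, hn2⟩ : ∃ n : T'.U ⟶ S'.U, n ≫ S'.fst = T'.fst ≫ z' ∧ n ≫ S'.snd = T'.snd :=
    ⟨S'.isPullback.lift (T'.fst ≫ z') T'.snd (by rw [Category.assoc, ← hb, T'.isPullback.w]),
      S'.isPullback.lift_fst _ _ _, S'.isPullback.lift_snd _ _ _⟩
  have ha : n ≫ a = b := by
    apply φ.isPullback.hom_ext
    · rw [Category.assoc, h.apex_fst, reassoc_of% hn1, reassoc_of% w, k.apex_fst, e.b]
    · rw [Category.assoc, h.apex_snd, hn2, k.apex_snd]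
  refine ⟨n, ⟨hb, hn1, hn2⟩, S.isPullback.hom_ext ?_ ?_⟩
  · rw [Category.assoc, Category.assoc, h.fst, e.fst, reassoc_of% hn1, reassoc_of% k.fst, w]
  · rw [Category.assoc, Category.assoc, ← h.sharp, reassoc_of% ha, e.snd, k.sharp]

theorem baseChange {φ : p ⟶ p'} {S : Step p X} {S' : Step p' X} {S'' : Step p' X''}
    {x : X'' ⟶ X} {c : S'.U ⟶ S.U} {c' : S''.U ⟶ S'.U}
    (h : Acts φ S S' (𝟙 X) c) (k : S'.BaseChange S'' x c') : Acts φ S S'' x (c' ≫ c) := by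
  obtain ⟨φ, a, rfl, h⟩ := h
  refine ⟨φ, c' ≫ a, rfl, ?_, ?_, ?_, ?_, ?_⟩
  · rw [k.b, h.b, Category.id_comp]
  · rw [Category.assoc, h.fst, Category.comp_id, k.fst]
  · rw [Category.assoc, h.apex_fst, Category.id_comp, reassoc_of% k.fst]
  · rw [Category.assoc, h.apex_snd, k.snd]
  · rw [Category.assoc, h.sharp, Category.assoc]

theorem exists_acts (φ : p ⟶ p') (S : Step p X) (x : X' ⟶ X) : ∃ S' c, Acts φ S S' x c := by
  obtain ⟨S', c, h⟩ := exists_acts_id φ S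
  obtain ⟨S'', c', k⟩ := S'.exists_baseChange x
  exact ⟨S'', c' ≫ c, h.baseChange k⟩

/-- A morphism is determined by its action. -/
theorem hom_ext {φ ψ : p ⟶ p'} (h : ∀ (X : E) (S : Step p X), ∃ S' c,
    Acts φ S S' (𝟙 X) c ∧ Acts ψ S S' (𝟙 X) c) : φ = ψ := by
  -- Over the universal step, `S'` and `c` themselves form a diagram, and it is isomorphic to the
  -- representatives of both morphisms.
  obtain ⟨S', c, ⟨φ, a, rfl, hφ⟩, ⟨ψ, a', rfl, hψ⟩⟩ := h _ (Step.univ p)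
  have aux : ∀ (χ : Diagram p p') (d : S'.U ⟶ χ.apex), χ.Acts (Step.univ p) S' (𝟙 _) c d →
      Diagram.Rel ⟨S'.b, S'.U, S'.fst, S'.snd, S'.isPullback, c,
        hφ.fst.trans (Category.comp_id _)⟩ χ := by
    intro χ d h
    refine Diagram.Rel.of_hom ?_ d ?_ h.apex_snd ?_
    · exact h.b.trans ((Category.id_comp _).trans (Category.id_comp _))
    · exact h.apex_fst.trans ((congrArg _ (Category.id_comp _)).trans (Category.comp_id _))
    · exact h.sharp.trans (Category.comp_id _)
  exact Quotient.sound ((Diagram.rel_equivalence _ _).trans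
    ((Diagram.rel_equivalence _ _).symm (aux φ a hφ)) (aux ψ a' hψ))

/-- A pullback of `p'` over `p.base` with a map to `p.total` is the action of a morphism. -/
theorem exists_hom (S' : Step p' p.base) (c : S'.U ⟶ p.total) (hc : c ≫ p.hom = S'.fst) :
    ∃ φ : p ⟶ p', ∀ {X : E} {S : Step p X} {T : Step p' X} {d : T.U ⟶ S.U} {n : T.U ⟶ S'.U},
      S'.BaseChange T S.b n → d ≫ S.fst = T.fst → n ≫ c = d ≫ S.snd → Acts φ S T (𝟙 X) d := by
  refine ⟨Diagram.toHom ⟨S'.b, S'.U, S'.fst, S'.snd, S'.isPullback, c, hc⟩, ?_⟩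
  intro X S T d n h hd hn
  refine ⟨_, n, rfl, ?_, ?_, ?_, h.snd, hn⟩
  · rw [h.b, Category.id_comp]
  · rw [hd, Category.comp_id]
  · rw [Category.id_comp]
    exact h.fst

end Acts

end Pullbacks

/-! ### The action of a composition product of morphisms -/

section

variable [HasFiniteLimits E] {p p' q q' : CatPoly E} {X X' : E}

/-- With `Diagram.acts_inner`, this reads `triShape` as the result of acting on the universal pair;
the targets are its two pullbacks by definition. -/
theorem Diagram.acts_outer (φ : Diagram p p') (q : CatPoly E) :
    φ.Acts (Step.outer p q) ⟨(p.dist q).hom ≫ φ.pos, pullback (p.dist q).hom φ.fst,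
      pullback.fst _ _, pullback.snd _ _ ≫ φ.snd,
      (IsPullback.of_hasPullback (p.dist q).hom φ.fst).paste_vert φ.isPullback⟩
      (𝟙 (p.dist q).left) (triMid φ) (pullback.snd _ _) where
  b := (Category.id_comp _).symm
  fst := (pullback.lift_fst _ _ _).trans (Category.comp_id _).symm
  apex_fst := pullback.condition.symm.trans (congrArg _ (Category.id_comp _).symm)
  apex_snd := rfl
  sharp := (pullback.lift_snd _ _ _).symm

theorem Diagram.acts_inner (φ : Diagram p p') (ψ : Diagram q q') :
    ψ.Acts (Step.inner p q) ⟨(triMid φ ≫ p.ev q) ≫ ψ.pos, pullback (triMid φ ≫ p.ev q) ψ.fst,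
      pullback.fst _ _, pullback.snd _ _ ≫ ψ.snd,
      (IsPullback.of_hasPullback (triMid φ ≫ p.ev q) ψ.fst).paste_vert ψ.isPullback⟩
      (triMid φ) (triSharp φ ψ) (pullback.snd _ _) where
  b := Category.assoc _ _ _
  fst := pullback.lift_fst _ _ _
  apex_fst := pullback.condition.symm
  apex_snd := rfl
  sharp := (pullback.lift_snd _ _ _).symm

/-- For the universal pair this is how `triDiagram` was defined. Any other pair is a base change of
that one, and naturality of the actions of `φ` and then `ψ` carries the result over. Note that `ψ`
acts along `c`, the effect of `φ` on directions. -/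
theorem Acts.tri {φ : p ⟶ p'} {ψ : q ⟶ q'} {S : Step p X} {S' : Step p' X'} {x : X' ⟶ X}
    {c : S'.U ⟶ S.U} {T : Step q S.U} {T' : Step q' S'.U} {d : T'.U ⟶ T.U}
    (h : Acts φ S S' x c) (k : Acts ψ T T' c d) :
    Acts (triHom φ ψ) (S.tri T) (S'.tri T') x d := by
  obtain ⟨φ, a, rfl, h⟩ := h
  obtain ⟨ψ, a', rfl, k⟩ := k
  obtain ⟨m, hm, km⟩ := Step.exists_mid S T
  obtain ⟨c', hc, hcm⟩ := (φ.acts_outer q).exists_baseChange h hm (Category.comp_id _)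
  obtain ⟨d', hd, hdn⟩ := (Diagram.acts_inner φ ψ).exists_baseChange k km hcm
  refine Acts.of_diagram (φ := triDiagram φ ψ) (hc.tri hd) ?_ hdn
  show d ≫ T.fst ≫ S.fst = (T'.fst ≫ S'.fst) ≫ x
  rw [reassoc_of% k.fst, h.fst, Category.assoc]

end

end CatPoly

/-! ### The action of the unitors and the associator -/

namespace CatPoly

variable {E : Type u} [Category.{v} E] [HasFiniteLimits E] {p q r : CatPoly E} {X : E}

instance : IsIso (y : CatPoly E).hom := inferInstanceAs (IsIso (𝟙 (⊤_ E)))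

namespace Step

instance (S : Step (y : CatPoly E) X) : IsIso S.fst := S.isPullback.isIso_fst_of_isIso

theorem hom_base_ext {Z : E} (f g : Z ⟶ (y : CatPoly E).base) : f = g :=
  Subsingleton.elim (α := Z ⟶ ⊤_ E) f g

theorem hom_total_ext {Z : E} (f g : Z ⟶ (y : CatPoly E).total) : f = g :=
  Subsingleton.elim (α := Z ⟶ ⊤_ E) f g

/-- The trivial pullback of `y`. -/
noncomputable abbrev unit (X : E) : Step (y : CatPoly E) X where
  b := terminal.from X
  U := X
  fst := 𝟙 X
  snd := terminal.from X
  isPullback := IsPullback.of_horiz_isIso ⟨hom_base_ext _ _⟩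

/-- The other two conditions equate maps into the terminal object. -/
theorem baseChange_unit {X' : E} {S : Step (y : CatPoly E) X} {S' : Step (y : CatPoly E) X'}
    {x : X' ⟶ X} {c : S'.U ⟶ S.U} (h : c ≫ S.fst = S'.fst ≫ x) : S.BaseChange S' x c :=
  ⟨hom_base_ext _ _, h, hom_total_ext _ _⟩

/-- Transport of a pullback along the isomorphism `S.fst`. -/
noncomputable abbrev push (S : Step (y : CatPoly E) X) (T : Step p S.U) : Step p X where
  b := inv S.fst ≫ T.b
  U := T.U
  fst := T.fst ≫ S.fst
  snd := T.snd
  isPullback := by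
    have h : IsPullback (T.fst ≫ S.fst) (𝟙 _) (inv S.fst) T.fst :=
      (IsPullback.of_vert_isIso ⟨by simp⟩)
    simpa using h.paste_vert T.isPullback

theorem baseChange_push (S : Step (y : CatPoly E) X) (T : Step p S.U) :
    T.BaseChange (S.push T) (inv S.fst) (𝟙 T.U) where
  b := rfl
  fst := by simp
  snd := Category.id_comp _

end Step

namespace Acts

/-- The target is `S.push T` because `T` lives over `S.U`, which is only isomorphic to `X`. -/
theorem leftUnitor (S : Step y X) (T : Step p S.U) :
    Acts (leftUnitorDiagram p).toHom (S.tri T) (S.push T) (𝟙 X) (𝟙 T.U) := by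
  obtain ⟨m, hm, km⟩ := Step.exists_mid S T
  refine of_diagram (φ := leftUnitorDiagram p) (n := (S.tri T).snd) ⟨?_, ?_, ?_⟩ ?_ ?_
  · rw [Category.id_comp]
    refine (IsIso.inv_comp_eq _).2 (km.b.trans ?_)
    have h : m ≫ y.midFst p = S.fst ≫ (S.tri T).b := hm.fst
    -- Since `leftSection p` inverts `y.midFst p`, the map `m` is determined by its image in the
    -- base.
    have h' : S.fst ≫ (S.tri T).b ≫ leftSection p = m := by
      rw [← reassoc_of% h, fst_leftSection, Category.comp_id]
    exact (congrArg (· ≫ y.ev p) h'.symm).trans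
      ((Category.assoc _ _ _).trans (congrArg _ (Category.assoc _ _ _)))
  · rw [Category.id_comp]
    exact (S.tri T).isPullback.w.symm
  · exact km.snd
  · exact (Category.id_comp _).trans (Category.comp_id _).symm
  · exact (Category.comp_id _).trans (Category.id_comp _).symm

theorem rightUnitor (S : Step p X) (T : Step y S.U) :
    Acts (rightUnitorDiagram p).toHom (S.tri T) S (𝟙 X) (inv T.fst) := by
  obtain ⟨m, hm, km⟩ := Step.exists_mid S T
  refine of_diagram (φ := rightUnitorDiagram p) (n := inv T.fst ≫ (S.tri T).snd) ⟨?_, ?_, ?_⟩ ?_ ?_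
  · rw [Category.id_comp]
    exact hm.b
  · rw [Category.id_comp]
    refine (Category.assoc _ _ _).trans ((IsIso.inv_comp_eq _).2 ?_)
    exact (S.tri T).isPullback.w.symm.trans (Category.assoc _ _ _)
  · refine (Category.assoc _ _ _).trans ((IsIso.inv_comp_eq _).2 ?_)
    refine ((reassoc_of% km.fst) (p.midSnd y)).trans (congrArg _ hm.snd)
  · exact (IsIso.inv_hom_id_assoc _ _).trans (Category.comp_id _).symm
  · exact Category.comp_id _

/-- The shape defining the associator is the regrouped universal triple. The triple `(S, T, W)` is a
base change of it, one layer at a time, and two uses of `BaseChange.tri` reassemble the layers in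
the new grouping. -/
theorem associator (S : Step p X) (T : Step q S.U) (W : Step r T.U) :
    Acts (assocDiagram p q r).toHom ((S.tri T).tri W) (S.tri (T.tri W)) (𝟙 X) (𝟙 W.U) := by
  obtain ⟨m, hm, km⟩ := Step.exists_mid S T
  obtain ⟨n, hn, kn⟩ := Step.exists_mid (S.tri T) W
  let Sh := assocShape p q r
  let In := assocInner p q r
  let S₀ : Step p ((p.tri q).tri r).base := ⟨Sh.b, Sh.U, Sh.U_fst, Sh.U_snd, Sh.hU⟩
  let T₀ : Step q (assocMid p q r) := ⟨In.b, In.U, In.U_fst, In.U_snd, In.hU⟩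
  have hb : (S.tri T).b = ((S.tri T).tri W).b ≫ (p.tri q).triFst r := hn.b
  have hc : (S.fst ≫ ((S.tri T).tri W).b) ≫ (p.tri q).triFst r = m ≫ p.midFst q := by
    rw [Category.assoc, ← hb]
    exact hm.fst.symm
  let c : S.U ⟶ assocMid p q r := pullback.lift _ _ hc
  have hc1 : c ≫ pullback.fst _ _ = S.fst ≫ ((S.tri T).tri W).b := pullback.lift_fst _ _ _
  have hc2 : c ≫ pullback.snd _ _ = m := pullback.lift_snd _ _ _
  have hS : S₀.BaseChange S ((S.tri T).tri W).b c := by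
    refine ⟨?_, hc1, ((reassoc_of% hc2) _).trans hm.snd⟩
    refine hm.b.trans ((congrArg (· ≫ p.triFst q) hb).trans (Category.assoc _ _ _))
  have hn2 : n ≫ (p.tri q).midSnd r = (S.tri T).snd := hn.snd
  have hnc : n ≫ assocProj p q r = T.fst ≫ c := by
    apply pullback.hom_ext
    · rw [Category.assoc, assocProj, pullback.lift_fst]
      exact hn.fst.trans ((Category.assoc _ _ _).trans
        ((congrArg _ hc1.symm).trans (Category.assoc _ _ _).symm))
    · rw [Category.assoc, assocProj, pullback.lift_snd, reassoc_of% hn2]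
      exact km.fst.trans ((congrArg _ hc2.symm).trans (Category.assoc _ _ _).symm)
  have hT : T₀.BaseChange T c n :=
    ⟨km.b.trans ((reassoc_of% hc2) _).symm, hnc, ((reassoc_of% hn2) _).trans km.snd⟩
  -- By definition, the second step in `assocShape` is the pair of `T₀` and the universal pullback
  -- of `r` in `(p ◁ q) ◁ r`.
  have h := hS.tri (hT.tri (q := r) (T := Step.inner (p.tri q) r) kn)
  refine of_diagram (φ := assocDiagram p q r) (n := ((S.tri T).tri W).snd) ?_ ?_ ?_
  · rw [Category.id_comp]
    exact h
  · refine (Category.id_comp _).trans (Eq.trans ?_ (Category.comp_id _).symm)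
    exact (Category.assoc _ _ _).symm
  · exact (Category.comp_id _).trans (Category.id_comp _).symm

end Acts

end CatPoly

/-! ### Invertibility of the structure maps -/

namespace CatPoly

variable {E : Type u} [Category.{v} E] [HasFiniteLimits E] {p q r : CatPoly E} {X : E}

theorem Acts.id (S : Step p X) : Acts (𝟙 p) S S (𝟙 X) (𝟙 S.U) :=
  id_iff.2 (Step.BaseChange.refl S)

theorem Acts.congr {φ : p ⟶ q} {S : Step p X} {S' : Step q X} {c c' : S'.U ⟶ S.U}
    (h : Acts φ S S' (𝟙 X) c) (e : c = c') : Acts φ S S' (𝟙 X) c' := e ▸ h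

/-- The inverse is obtained by splitting the universal step of `p ◁ (q ◁ r)` into three and
regrouping it. Every triple is a base change of this one, layer by layer, so the inverse regroups
all triples. -/
instance isIso_assocDiagram (p q r : CatPoly E) : IsIso (assocDiagram p q r).toHom := by
  obtain ⟨S, V, e⟩ := Step.exists_eq_tri (Step.univ (p.tri (q.tri r)))
  obtain ⟨T, W, rfl⟩ := Step.exists_eq_tri V
  have hb : (S.tri (T.tri W)).b = 𝟙 _ := (congrArg Step.b e).symm
  -- `W.U` is the total space only through `e`, so `snd` stands in for the identity on directions.
  obtain ⟨φ, hφ⟩ := Acts.exists_hom ((S.tri T).tri W) (S.tri (T.tri W)).snd (by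
    rw [← (S.tri (T.tri W)).isPullback.w, hb]
    exact (Category.comp_id _).trans (Category.assoc _ _ _))
  have key : ∀ (X : E) (S' : Step p X) (T' : Step q S'.U) (W' : Step r T'.U),
      Acts φ (S'.tri (T'.tri W')) ((S'.tri T').tri W') (𝟙 X) (𝟙 W'.U) := by
    intro X S' T' W'
    obtain ⟨n, h⟩ : ∃ n, (S.tri (T.tri W)).BaseChange (S'.tri (T'.tri W'))
        (S'.tri (T'.tri W')).b n := by
      rw [← e]
      exact ⟨_, Step.baseChange_univ _⟩
    obtain ⟨c, h1, h2⟩ := h.exists_of_tri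
    obtain ⟨d, h3, h4⟩ := h2.exists_of_tri
    refine hφ ((h1.tri h3).tri h4) ?_ ?_
    · exact (Category.id_comp _).trans (Category.assoc _ _ _)
    · exact h.snd.trans (Category.id_comp _).symm
  refine ⟨φ, Acts.hom_ext fun X S => ?_, Acts.hom_ext fun X S => ?_⟩
  · obtain ⟨V, W, rfl⟩ := Step.exists_eq_tri S
    obtain ⟨S, T, rfl⟩ := Step.exists_eq_tri V
    exact ⟨_, _, (Acts.associator S T W).comp (key X S T W),
      (Acts.id _).congr (Category.id_comp _).symm⟩
  · obtain ⟨S, V, rfl⟩ := Step.exists_eq_tri S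
    obtain ⟨T, W, rfl⟩ := Step.exists_eq_tri V
    exact ⟨_, _, (key X S T W).comp (Acts.associator S T W),
      (Acts.id _).congr (Category.id_comp _).symm⟩

/-- The inverse puts the trivial step of `y` in front of a step of `p`. -/
instance isIso_leftUnitorDiagram (p : CatPoly E) : IsIso (leftUnitorDiagram p).toHom := by
  obtain ⟨φ, hφ⟩ := Acts.exists_hom ((Step.unit p.base).tri (Step.univ p)) (𝟙 p.total)
    ((Category.id_comp _).trans (Category.comp_id _).symm)
  have key : ∀ (X : E) (T : Step p X), Acts φ T ((Step.unit X).tri T) (𝟙 X) (𝟙 T.U) := by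
    intro X T
    have h : (Step.unit p.base).BaseChange (Step.unit X) T.b T.b :=
      Step.baseChange_unit ((Category.comp_id _).trans (Category.id_comp _).symm)
    have h' : ((Step.unit p.base).tri (Step.univ p)).BaseChange ((Step.unit X).tri T) T.b T.snd :=
      Step.BaseChange.tri (S := Step.unit p.base) (T := Step.univ p) (S' := Step.unit X) (T' := T) h
        T.baseChange_univ
    refine hφ (T := (Step.unit X).tri T) h' ?_ ?_
    · exact (Category.id_comp _).trans (Category.comp_id _).symm
    · exact (Category.comp_id _).trans (Category.id_comp _).symm
  refine ⟨φ, Acts.hom_ext fun X S => ?_, Acts.hom_ext fun X T => ?_⟩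
  · obtain ⟨S, T, rfl⟩ := Step.exists_eq_tri S
    -- The round trip replaces `S` by `Step.unit X`; the new pair is a base change of the old one
    -- along `𝟙 X`, which `id_iff` accepts as an action of the identity.
    refine ⟨_, _, (Acts.leftUnitor S T).comp (key X _), Acts.id_iff.2 ?_⟩
    have h : S.BaseChange (Step.unit X) (𝟙 X) (inv S.fst) :=
      Step.baseChange_unit ((IsIso.inv_hom_id _).trans (Category.id_comp _).symm)
    exact (Category.id_comp (𝟙 T.U)).symm ▸ h.tri (S.baseChange_push T)
  · refine ⟨_, _, (key X T).comp (Acts.leftUnitor (Step.unit X) T), Acts.id_iff.2 ⟨?_, ?_, ?_⟩⟩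
    · exact congrArg (· ≫ T.b) (IsIso.inv_id (X := X))
    · simp
    · simp

/-- The inverse appends the trivial step of `y` over the directions of a step of `p`. -/
instance isIso_rightUnitorDiagram (p : CatPoly E) : IsIso (rightUnitorDiagram p).toHom := by
  obtain ⟨φ, hφ⟩ := Acts.exists_hom ((Step.univ p).tri (Step.unit p.total)) (𝟙 p.total)
    ((Category.id_comp _).trans (Category.id_comp _).symm)
  have key : ∀ (X : E) (S : Step p X), Acts φ S (S.tri (Step.unit S.U)) (𝟙 X) (𝟙 S.U) := by
    intro X S
    have h : (Step.unit p.total).BaseChange (Step.unit S.U) S.snd S.snd :=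
      Step.baseChange_unit ((Category.comp_id _).trans (Category.id_comp _).symm)
    refine hφ (S.baseChange_univ.tri h) ?_ ?_
    · rfl
    · exact (Category.comp_id _).trans (Category.id_comp _).symm
  refine ⟨φ, Acts.hom_ext fun X S => ?_, Acts.hom_ext fun X S => ?_⟩
  · obtain ⟨S, T, rfl⟩ := Step.exists_eq_tri S
    refine ⟨_, _, (Acts.rightUnitor S T).comp (key X _), Acts.id_iff.2 ?_⟩
    have h : T.BaseChange (Step.unit S.U) (𝟙 S.U) (inv T.fst) :=
      Step.baseChange_unit ((IsIso.inv_hom_id _).trans (Category.id_comp _).symm)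
    exact (Category.id_comp (inv T.fst)).symm ▸ (Step.BaseChange.refl S).tri h
  · exact ⟨_, _, (key X S).comp (Acts.rightUnitor S (Step.unit S.U)),
      (Acts.id S).congr (by simp)⟩

/-! ### Functoriality, naturality and coherence -/

section

variable {p' q' r' p'' q'' : CatPoly E}

theorem triHom_id (p q : CatPoly E) : triHom (𝟙 p) (𝟙 q) = 𝟙 (p.tri q) := by
  refine Acts.hom_ext fun X S => ?_
  obtain ⟨S, T, rfl⟩ := Step.exists_eq_tri S
  exact ⟨_, _, (Acts.id S).tri (Acts.id T), Acts.id _⟩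

theorem triHom_comp (φ : p ⟶ p') (φ' : p' ⟶ p'') (ψ : q ⟶ q') (ψ' : q' ⟶ q'') :
    triHom (φ ≫ φ') (ψ ≫ ψ') = triHom φ ψ ≫ triHom φ' ψ' := by
  refine Acts.hom_ext fun X S => ?_
  obtain ⟨S, T, rfl⟩ := Step.exists_eq_tri S
  obtain ⟨S', c, h⟩ := Acts.exists_acts φ S (𝟙 X)
  obtain ⟨S'', c', h'⟩ := Acts.exists_acts φ' S' (𝟙 X)
  -- `T'` has to lie over `S'.U`, so `ψ` acts along `c` and not along an identity.
  obtain ⟨T', d, k⟩ := Acts.exists_acts ψ T c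
  obtain ⟨T'', d', k'⟩ := Acts.exists_acts ψ' T' c'
  refine ⟨S''.tri T'', _, ?_, (h.tri k).comp (h'.tri k')⟩
  exact (h.comp h').tri (k.comp_of_hom k')

theorem associator_naturality (φ : p ⟶ p') (ψ : q ⟶ q') (χ : r ⟶ r') :
    triHom (triHom φ ψ) χ ≫ (assocDiagram p' q' r').toHom =
      (assocDiagram p q r).toHom ≫ triHom φ (triHom ψ χ) := by
  refine Acts.hom_ext fun X S => ?_
  obtain ⟨V, W, rfl⟩ := Step.exists_eq_tri S
  obtain ⟨S, T, rfl⟩ := Step.exists_eq_tri V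
  obtain ⟨S', c, h⟩ := Acts.exists_acts φ S (𝟙 X)
  obtain ⟨T', d, k⟩ := Acts.exists_acts ψ T c
  obtain ⟨W', e, l⟩ := Acts.exists_acts χ W d
  have hl := (Acts.tri (S := S.tri T) (S' := S'.tri T') (h.tri k) l).comp (Acts.associator S' T' W')
  exact ⟨_, _, hl, ((Acts.associator S T W).comp (h.tri (k.tri l))).congr
    ((Category.comp_id _).trans (Category.id_comp _).symm)⟩

theorem leftUnitor_naturality (φ : p ⟶ p') :
    triHom (𝟙 y) φ ≫ (leftUnitorDiagram p').toHom = (leftUnitorDiagram p).toHom ≫ φ := by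
  refine Acts.hom_ext fun X S => ?_
  obtain ⟨S, T, rfl⟩ := Step.exists_eq_tri S
  obtain ⟨T', c, h⟩ := Acts.exists_acts φ T (𝟙 S.U)
  -- Pushing along the isomorphism `S.fst` moves the action of `φ` from the stage `S.U` to the stage
  -- `X`.
  have h' : Acts φ (S.push T) (S.push T') (𝟙 X) c := by
    obtain ⟨φ, a, rfl, h⟩ := h
    have hb : T'.b = T.b ≫ φ.pos := h.b.trans (Category.id_comp _)
    have hf : c ≫ T.fst = T'.fst := h.fst.trans (Category.comp_id _)
    have ha : a ≫ φ.fst = T'.fst ≫ T.b := h.apex_fst.trans (congrArg _ (Category.id_comp _))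
    refine ⟨φ, a, rfl, ?_, ?_, ?_, h.apex_snd, h.sharp⟩
    · simp [hb]
    · simp [reassoc_of% hf]
    · simp [ha]
  exact ⟨_, _, ((Acts.id S).tri h).comp (Acts.leftUnitor S T'),
    ((Acts.leftUnitor S T).comp h').congr
      ((Category.comp_id _).trans (Category.id_comp _).symm)⟩

theorem rightUnitor_naturality (φ : p ⟶ p') :
    triHom φ (𝟙 y) ≫ (rightUnitorDiagram p').toHom = (rightUnitorDiagram p).toHom ≫ φ := by
  refine Acts.hom_ext fun X S => ?_
  obtain ⟨S, T, rfl⟩ := Step.exists_eq_tri S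
  obtain ⟨S', c, h⟩ := Acts.exists_acts φ S (𝟙 X)
  obtain ⟨T', d, k⟩ := Acts.exists_acts (𝟙 y) T c
  refine ⟨_, _, (h.tri k).comp (Acts.rightUnitor S' T'),
    ((Acts.rightUnitor S T).comp h).congr ?_⟩
  -- As `𝟙 y` acts by base change, `d` lies over `c`; inverting the two projections gives the
  -- equality on directions.
  rw [IsIso.comp_inv_eq, Category.assoc, (Acts.id_iff.1 k).fst, IsIso.inv_hom_id_assoc]

theorem triangle (p q : CatPoly E) :
    (assocDiagram p y q).toHom ≫ triHom (𝟙 p) (leftUnitorDiagram q).toHom =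
      triHom (rightUnitorDiagram p).toHom (𝟙 q) := by
  refine Acts.hom_ext fun X S => ?_
  obtain ⟨V, W, rfl⟩ := Step.exists_eq_tri S
  obtain ⟨S, T, rfl⟩ := Step.exists_eq_tri V
  -- The right unitor acts on directions by `inv T.fst`, so `𝟙 q` must act along it, and this
  -- produces the step `T.push W` that the left unitor gives on the other side.
  have h : Acts (𝟙 q) W (T.push W) (inv T.fst) (𝟙 W.U) := Acts.id_iff.2 (T.baseChange_push W)
  have hl := (Acts.associator S T W).comp ((Acts.id S).tri (Acts.leftUnitor T W))
  exact ⟨_, _, hl, ((Acts.rightUnitor S T).tri (T := W) h).congr (Category.id_comp _).symm⟩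

/-- Both sides regroup `(((R, S), T), W)` into `(R, (S, (T, W)))` and are the identity on
directions. -/
theorem pentagon (p q r s : CatPoly E) :
    triHom (assocDiagram p q r).toHom (𝟙 s) ≫ (assocDiagram p (q.tri r) s).toHom ≫
        triHom (𝟙 p) (assocDiagram q r s).toHom =
      (assocDiagram (p.tri q) r s).toHom ≫ (assocDiagram p q (r.tri s)).toHom := by
  refine Acts.hom_ext fun X S => ?_
  obtain ⟨V, W, rfl⟩ := Step.exists_eq_tri S
  obtain ⟨U, T, rfl⟩ := Step.exists_eq_tri V
  obtain ⟨R, S, rfl⟩ := Step.exists_eq_tri U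
  have hr := (Acts.associator (R.tri S) T W).comp (Acts.associator R S (T.tri W))
  have h1 := Acts.tri (S := (R.tri S).tri T) (S' := R.tri (S.tri T)) (T := W) (T' := W)
    (Acts.associator R S T) (Acts.id W)
  have h2 := (Acts.associator R (S.tri T) W).comp ((Acts.id R).tri (Acts.associator S T W))
  exact ⟨_, _, h1.comp h2, hr.congr (Category.comp_id _).symm⟩

end

end CatPoly

/-! ### The monoidal structure -/

theorem mainTheorem1 {E : Type u} [Category.{v} E] [HasFiniteLimits E] :
    ∃ (α : ∀ p q r : CatPoly E, (p.tri q).tri r ≅ p.tri (q.tri r))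
      (l : ∀ p : CatPoly E, CatPoly.y.tri p ≅ p)
      (ρ : ∀ p : CatPoly E, p.tri CatPoly.y ≅ p),
      (∀ p q r : CatPoly E, (α p q r).hom = (CatPoly.assocDiagram p q r).toHom) ∧
      (∀ p : CatPoly E, (l p).hom = (CatPoly.leftUnitorDiagram p).toHom) ∧
      (∀ p : CatPoly E, (ρ p).hom = (CatPoly.rightUnitorDiagram p).toHom) ∧
      ∃ M : MonoidalCategory (CatPoly E),
        M.toMonoidalCategoryStruct =
          { tensorObj := fun p q => p.tri q
            tensorUnit := CatPoly.y
            tensorHom := fun φ ψ => CatPoly.triHom φ ψ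
            whiskerLeft := fun p _ _ ψ => CatPoly.triHom (𝟙 p) ψ
            whiskerRight := fun φ q => CatPoly.triHom φ (𝟙 q)
            associator := α
            leftUnitor := l
            rightUnitor := ρ } := by
  refine ⟨fun p q r => asIso (CatPoly.assocDiagram p q r).toHom,
    fun p => asIso (CatPoly.leftUnitorDiagram p).toHom,
    fun p => asIso (CatPoly.rightUnitorDiagram p).toHom, fun _ _ _ => rfl, fun _ => rfl,
    fun _ => rfl, ?_⟩
  let M : MonoidalCategoryStruct (CatPoly E) :=
    { tensorObj := fun p q => p.tri q
      tensorUnit := CatPoly.y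
      tensorHom := fun φ ψ => CatPoly.triHom φ ψ
      whiskerLeft := fun p _ _ ψ => CatPoly.triHom (𝟙 p) ψ
      whiskerRight := fun φ q => CatPoly.triHom φ (𝟙 q)
      associator := fun p q r => asIso (CatPoly.assocDiagram p q r).toHom
      leftUnitor := fun p => asIso (CatPoly.leftUnitorDiagram p).toHom
      rightUnitor := fun p => asIso (CatPoly.rightUnitorDiagram p).toHom }
  exact ⟨MonoidalCategory.ofTensorHom (id_tensorHom_id := CatPoly.triHom_id)
    (tensorHom_comp_tensorHom := fun φ ψ φ' ψ' => (CatPoly.triHom_comp φ φ' ψ ψ').symm)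
    (associator_naturality := CatPoly.associator_naturality)
    (leftUnitor_naturality := CatPoly.leftUnitor_naturality)
    (rightUnitor_naturality := CatPoly.rightUnitor_naturality)
    (pentagon := CatPoly.pentagon) (triangle := CatPoly.triangle), rfl⟩
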